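/- Let $d\ge 1$, let $Q,B$ be real $d\times d$ matrices with $Q$ symmetric nonnegative definite, and put $Q_t=\int_0^t e^{sB}Qe^{sB^*}\,ds$. Assume $\det Q_t>0$ for all $t>0$, and that $B$ is diagonalizable with real negative eigenvalues: there are a real invertible matrix $M$ and $0<\lambda_1\le\cdots\le\lambda_d$ with $MBM^{-1}=-\operatorname{diag}(\lambda_1,\dots,\lambda_d)$. Let $P=(P_t)$ be the diffusion Ornstein–Uhlenbeck semigroup (Lévy measure $\Pi=0$) with generator $\frac12\operatorname{tr}(Q\nabla^2)+\langle Bx,\nabla\rangle$, that is, $P_tf(x)=\int f\,dN(e^{tB}x,Q_t)$. Let $Q_\infty=\int_0^\infty e^{sB}Qe^{sB^*}\,ds$ and let $\mu$ denote both the measure $N(0,Q_\infty)$ and its Lebesgue density. Let $\varrho$ be the smallest eigenvalue of $\lambda_1MQ_\infty M^*$, let $D=\operatorname{diag}(\sqrt{\lambda_1/\varrho},\dots,\sqrt{\lambda_d/\varrho})$, $T=DM$, and $u_j=T^{-1}e_j$ for $j=1,\dots,d$. For $n\in\mathbb N_0^d$ (with $|n|=n_1+\cdots+n_d$, $n!=n_1!\cdots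 n_d!$) define $\mathcal H_n$ through the Taylor expansion at $z=0$ $$\sum_{n\in\mathbb N_0^d}\mathcal H_n(x)\frac{z^n}{\sqrt{n!}}=\exp\Big(\langle Tx,z\rangle-\tfrac12\langle Q_\infty T^*z,T^*z\rangle\Big),$$ and put $$\mathcal G_n(x)=\frac{(-1)^{|n|}}{\sqrt{n!}}\,\frac{\partial_{u_1}^{n_1}\cdots\partial_{u_d}^{n_d}\mu(x)}{\mu(x)} .$$ Then $\mu$ is the unique invariant distribution of $P$; $\mathcal H_n,\mathcal G_n\in L^2(\mu)$ and $\langle\mathcal H_n,\mathcal G_m\rangle_{L^2(\mu)}=\delta_{mn}$ for all $m,n\in\mathbb N_0^d$; and there is a constant $t_0>0$, depending only on $Q$, $B$ and the chosen diagonalization $(M,\lambda)$ of $B$, such that for all $t>t_0$ and all complex-valued $f\in L^2(\mu)$, $P_tf$ is well defined $\mu$-almost everywhere by the integral above, belongs to $L^2(\mu)$, and $$P_tf=\sum_{n\in\mathbb N_0^d}e^{-t\langle n,\lambda\rangle}\,\langle f,\mathcal G_n\rangle_{L^2(\mu)}\,\mathcal H_n ,$$ where the series converges unconditionally in $L^2(\mu)$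 (its net of finite partial sums converges to $P_tf$). -/

import Mathlib

open MeasureTheory ProbabilityTheory Filter Topology

namespace OU

noncomputable section

variable {d : ℕ}

/-- The covariance matrix `Q_t = ∫₀ᵗ e^{sB} Q e^{sB*} ds` (entrywise integral). -/
def covT (Q B : Matrix (Fin d) (Fin d) ℝ) (t : ℝ) : Matrix (Fin d) (Fin d) ℝ :=
  Matrix.of fun i j => ∫ s in (0 : ℝ)..t,
    (NormedSpace.exp (s • B) * Q * (NormedSpace.exp (s • B)).transpose) i j

/-- The limiting covariance matrix `Q_∞ = ∫₀^∞ e^{sB} Q e^{sB*} ds` (entrywise integral). -/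
def covInf (Q B : Matrix (Fin d) (Fin d) ℝ) : Matrix (Fin d) (Fin d) ℝ :=
  Matrix.of fun i j => ∫ s in Set.Ioi (0 : ℝ),
    (NormedSpace.exp (s • B) * Q * (NormedSpace.exp (s • B)).transpose) i j

/-- The transition kernel of the diffusion Ornstein-Uhlenbeck process `dX = B X dt + Q^{1/2} dW`:
the law of `X_t` started from `x` is Gaussian with mean `e^{tB} x` and covariance `Q_t`, that is,
its characteristic function is `ξ ↦ exp (i ⟨e^{tB*} ξ, x⟩ - ⟨Q_t ξ, ξ⟩ / 2)`. -/
def kernel (Q B : Matrix (Fin d) (Fin d) ℝ) (t : ℝ) (x : EuclideanSpace ℝ (Fin d)) :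
    Measure (EuclideanSpace ℝ (Fin d)) :=
  multivariateGaussian (Matrix.toEuclideanLin (NormedSpace.exp (t • B)) x) (covT Q B t)

/-- The Ornstein-Uhlenbeck semigroup `P_t f (x) = 𝔼_x [f (X_t)]`. -/
def semigroup (Q B : Matrix (Fin d) (Fin d) ℝ) (t : ℝ) (f : EuclideanSpace ℝ (Fin d) → ℂ)
    (x : EuclideanSpace ℝ (Fin d)) : ℂ :=
  ∫ y, f y ∂(kernel Q B t x)

/-- `ν` is an invariant (probability) distribution of the Ornstein-Uhlenbeck semigroup. -/
def IsInvariantDistribution (Q B : Matrix (Fin d) (Fin d) ℝ)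
    (ν : Measure (EuclideanSpace ℝ (Fin d))) : Prop :=
  IsProbabilityMeasure ν ∧
    ∀ t : ℝ, 0 < t → ∀ s : Set (EuclideanSpace ℝ (Fin d)), MeasurableSet s →
      ∫⁻ x, kernel Q B t x s ∂ν = ν s

/-- The Lebesgue density of the centred Gaussian distribution with covariance `Q_∞`. -/
def density (Q B : Matrix (Fin d) (Fin d) ℝ) (x : EuclideanSpace ℝ (Fin d)) : ℝ :=
  (Real.sqrt ((2 * Real.pi) ^ d * (covInf Q B).det))⁻¹ *
    Real.exp (-(1 / 2) * inner ℝ (Matrix.toEuclideanLin (covInf Q B)⁻¹ x) x)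

/-- The measure `μ` with the above density; the theorem asserts that it is the unique invariant
distribution. -/
def invMeasure (Q B : Matrix (Fin d) (Fin d) ℝ) : Measure (EuclideanSpace ℝ (Fin d)) :=
  volume.withDensity fun x => ENNReal.ofReal (density Q B x)

/-- The smallest eigenvalue of a real symmetric matrix (of positive size). -/
def smallestEigenvalue (S : Matrix (Fin d) (Fin d) ℝ) : ℝ :=
  sInf {r : ℝ | Module.End.HasEigenvalue (Matrix.toLin' S) r}

/-- `ϱ`, the smallest eigenvalue of `λ₁ M Q_∞ M*`. -/
def rho [NeZero d] (Q B M : Matrix (Fin d) (Fin d) ℝ) (lam : Fin d → ℝ) : ℝ :=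
  smallestEigenvalue (lam 0 • (M * covInf Q B * M.transpose))

/-- The matrix `T = D M`, where `D = diag (√(λ_j / ϱ))`. -/
def coord [NeZero d] (Q B M : Matrix (Fin d) (Fin d) ℝ) (lam : Fin d → ℝ) :
    Matrix (Fin d) (Fin d) ℝ :=
  Matrix.diagonal (fun j => Real.sqrt (lam j / rho Q B M lam)) * M

/-- The directional derivative `x ↦ (∂_v g)(x)`. -/
def dirDeriv (v : EuclideanSpace ℝ (Fin d)) (g : EuclideanSpace ℝ (Fin d) → ℝ) :
    EuclideanSpace ℝ (Fin d) → ℝ :=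
  fun x => fderiv ℝ g x v

/-- The mixed derivative `∂_{u_1}^{n_1} ⋯ ∂_{u_d}^{n_d} g` along the directions `u_1, …, u_d`. -/
def mixedDeriv (u : Fin d → EuclideanSpace ℝ (Fin d)) (n : Fin d → ℕ)
    (g : EuclideanSpace ℝ (Fin d) → ℝ) : EuclideanSpace ℝ (Fin d) → ℝ :=
  (List.finRange d).foldr (fun j h => (dirDeriv (u j))^[n j] h) g

/-- `n! = n_1! ⋯ n_d!`. -/
def multiFactorial (n : Fin d → ℕ) : ℕ := ∏ j, (n j).factorial

/-- The generating function
`z ↦ exp (⟨T x, z⟩ - ⟨Q_∞ T* z, T* z⟩ / 2)` of the eigenfunctions. -/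
def genFun [NeZero d] (Q B M : Matrix (Fin d) (Fin d) ℝ) (lam : Fin d → ℝ)
    (x z : EuclideanSpace ℝ (Fin d)) : ℝ :=
  Real.exp (inner ℝ (Matrix.toEuclideanLin (coord Q B M lam) x) z -
    (1 / 2) * inner ℝ
      (Matrix.toEuclideanLin (covInf Q B * (coord Q B M lam).transpose) z)
      (Matrix.toEuclideanLin (coord Q B M lam).transpose z))

/-- The eigenfunction `ℋ_n`: `√(n!)` times the coefficient of `z^n` in the Taylor expansion
of the generating function at `z = 0`, so that `∑ ℋ_n (x) z^n / √(n!)` is that function. -/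
def eigenfun [NeZero d] (Q B M : Matrix (Fin d) (Fin d) ℝ) (lam : Fin d → ℝ) (n : Fin d → ℕ)
    (x : EuclideanSpace ℝ (Fin d)) : ℝ :=
  (Real.sqrt (multiFactorial n))⁻¹ *
    mixedDeriv (fun j => EuclideanSpace.single j 1) n (genFun Q B M lam x) 0

/-- The co-eigenfunction `𝒢_n = (-1)^{|n|} / √(n!) * ∂^n μ / μ`, where `∂^n` is taken in the
coordinates `y = T x`, that is, along the directions `u_j = T⁻¹ e_j`. -/
def coeigenfun [NeZero d] (Q B M : Matrix (Fin d) (Fin d) ℝ) (lam : Fin d → ℝ) (n : Fin d → ℕ)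
    (x : EuclideanSpace ℝ (Fin d)) : ℝ :=
  (-1) ^ (∑ j, n j) * (Real.sqrt (multiFactorial n))⁻¹ *
    (mixedDeriv
      (fun j => Matrix.toEuclideanLin (coord Q B M lam)⁻¹ (EuclideanSpace.single j 1)) n
      (density Q B) x / density Q B x)

end

end OU

/-!
# Spectral expansion of the Ornstein-Uhlenbeck semigroup with real diagonalizable drift

Put `S = Q_∞` and `T = coord`, so that `T e^{tB} = e^{-tΛ} T`. For a real matrix `A` the Gaussian
average `𝔼 ∏ⱼ (vⱼ + i Zⱼ) ^ nⱼ / √(n!)`, `Z ∼ N(0, A)`, is the normalised Hermite polynomial with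
generating function `exp (⟨z, v⟩ - ⟨A z, z⟩ / 2)`. Differentiating under the expectation identifies
the eigenfunctions with the Hermite family of `N(0, S)` in the coordinates `T x`
(`eigenfun_eq_hermiteFam`), and, after translating the density, the co-eigenfunctions with the Hermite
family in the coordinates `K x`, `K = (T⁻¹)* S⁻¹` (`coeigenfun_eq_hermiteFam`). The generating
functions satisfy `∫ gen_T(z) gen_K(w) dN(0, S) = exp ⟨z, T S K* w⟩ = exp ⟨z, w⟩`, which is
biorthogonality once coefficients are compared (`integral_hermiteFam_mul_hermiteFam`).

The Gaussian representation also bounds the `L²` norms of both families by `C R^{|n|}`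
(`exists_norm_toLp_hermiteFam_le`). Hence for large `t` the series
`∑ e^{-t⟨n, λ⟩} ⟨f, 𝒢_n⟩ ℋ_n` converges absolutely in operator norm on `L²(μ)`. The semigroup is a
bounded operator on `L²(μ)` by invariance of `μ` (`exists_continuousLinearMap_kernel`), so the two
sides need to be compared on a total set only. The characters `e^{i⟨ξ, x⟩}` are total
(`dense_span_characters`), they are multiples of `gen_T(w)` for imaginary `w`, and the semigroup sends
`gen_T(w)` to `gen_T(e^{-tΛ} w)`; expanding both in powers of `w` gives the equality
(`hasSum_semigroup`).

Invariance and uniqueness are read off characteristic functions, from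
`Q_∞ = Q_t + e^{tB} Q_∞ e^{tB*}` and `e^{tB} → 0`.
-/

namespace OU

/-! ### Power series in several variables -/

theorem hasSum_pi_prod {d : ℕ} (f : Fin d → ℕ → ℂ) (a : Fin d → ℂ)
    (hs : ∀ j, Summable fun k => ‖f j k‖) (h : ∀ j, HasSum (f j) (a j)) :
    (Summable fun n : Fin d → ℕ => ‖∏ j, f j (n j)‖) ∧
      HasSum (fun n : Fin d → ℕ => ∏ j, f j (n j)) (∏ j, a j) := by
  induction d with
  | zero =>
    refine ⟨Summable.of_finite, ?_⟩
    simp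
  | succ d ih =>
    obtain ⟨ih1, ih2⟩ := ih (fun j => f j.succ) (fun j => a j.succ) (fun j => hs _) (fun j => h _)
    rw [← (Fin.consEquiv (fun _ => ℕ)).summable_iff, ← (Fin.consEquiv (fun _ => ℕ)).hasSum_iff,
      Fin.prod_univ_succ]
    have e1 : (fun n : Fin (d + 1) → ℕ => ∏ j, f j (n j)) ∘ (Fin.consEquiv (fun _ => ℕ)) =
        fun p : ℕ × (Fin d → ℕ) => f 0 p.1 * ∏ j : Fin d, f j.succ (p.2 j) := by
      ext p; simp [Fin.prod_univ_succ, Fin.consEquiv]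
    have e2 : (fun n : Fin (d + 1) → ℕ => ‖∏ j, f j (n j)‖) ∘ (Fin.consEquiv (fun _ => ℕ)) =
        fun p : ℕ × (Fin d → ℕ) => ‖f 0 p.1‖ * ‖∏ j : Fin d, f j.succ (p.2 j)‖ := by
      ext p; simp [Fin.prod_univ_succ, Fin.consEquiv]
    rw [e1, e2]
    refine ⟨(hs 0).mul_of_nonneg ih1 (fun _ => norm_nonneg _) (fun _ => norm_nonneg _), ?_⟩
    exact HasSum.mul (f := f 0) (g := fun n : Fin d → ℕ => ∏ j : Fin d, f j.succ (n j)) (h 0) ih2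
      (summable_mul_of_summable_norm (f := f 0)
        (g := fun n : Fin d → ℕ => ∏ j : Fin d, f j.succ (n j)) (hs 0) ih1)

/-- The exponential series in several variables. -/
theorem hasSum_exp_pi {d : ℕ} (z : Fin d → ℂ) :
    HasSum (fun n : Fin d → ℕ => ∏ j, z j ^ n j / ((n j).factorial : ℂ))
      (Complex.exp (∑ j, z j)) := by
  rw [Complex.exp_sum]
  refine (hasSum_pi_prod (fun j k => z j ^ k / (k.factorial : ℂ)) _ (fun j => ?_) fun j => ?_).2
  · exact NormedSpace.norm_expSeries_div_summable (z j)
  · rw [Complex.exp_eq_exp_ℂ]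
    exact NormedSpace.expSeries_div_hasSum_exp (z j)

theorem summable_geometric_pi {d : ℕ} {q : ℝ} (hq : 0 ≤ q) (hq1 : q < 1) :
    Summable fun n : Fin d → ℕ => q ^ ∑ j, n j := by
  have hq' : ‖(q : ℂ)‖ = q := by simp [abs_of_nonneg hq]
  refine ((hasSum_pi_prod (fun (_ : Fin d) k => (q : ℂ) ^ k) _ (fun j => ?_) (fun j =>
    hasSum_geometric_of_norm_lt_one (by rw [hq']; exact hq1))).1).congr fun n => ?_
  · simpa [abs_of_nonneg hq] using summable_geometric_of_lt_one hq hq1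
  · simp [Finset.prod_pow_eq_pow_sum, abs_of_nonneg hq]

theorem prod_sqrt_factorial {d : ℕ} (n : Fin d → ℕ) :
    Real.sqrt (multiFactorial n) = ∏ j, Real.sqrt ((n j).factorial) := by
  rw [multiFactorial, Nat.cast_prod]
  exact Real.sqrt_prod _ (fun _ _ => by positivity)

theorem sqrt_multiFactorial_ne_zero {d : ℕ} (n : Fin d → ℕ) :
    (Real.sqrt (multiFactorial n) : ℂ) ≠ 0 := by
  rw [Complex.ofReal_ne_zero, Real.sqrt_ne_zero', multiFactorial]
  exact_mod_cast Finset.prod_pos fun j _ => (n j).factorial_pos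

theorem sqrt_multiFactorial_mul_self {d : ℕ} (n : Fin d → ℕ) :
    (Real.sqrt (multiFactorial n) : ℂ) * (Real.sqrt (multiFactorial n) : ℂ) =
      ∏ j, ((n j).factorial : ℂ) := by
  rw [← Complex.ofReal_mul, Real.mul_self_sqrt (by positivity), multiFactorial]
  simp

/-- Splitting `x ^ n / √(n!)` as `2⁻ⁿ · (2x) ^ n / √(n!)` bounds it by a geometric plus an
exponential series. -/
theorem summable_pow_div_sqrt_factorial (x : ℝ) (hx : 0 ≤ x) :
    Summable fun n : ℕ => x ^ n / Real.sqrt n.factorial := by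
  have h1 : Summable fun n : ℕ => ((1 / 2 : ℝ) ^ n) := summable_geometric_two
  have h2 : Summable fun n : ℕ => (4 * x ^ 2) ^ n / (n.factorial : ℝ) :=
    Real.summable_pow_div_factorial _
  refine Summable.of_nonneg_of_le (fun n => by positivity) (fun n => ?_) (h1.add h2)
  set s := Real.sqrt n.factorial
  have hs : 0 < s := Real.sqrt_pos.2 (by positivity)
  have hss : (n.factorial : ℝ) = s ^ 2 := (Real.sq_sqrt (by positivity)).symm
  have e : (4 * x ^ 2) ^ n / (n.factorial : ℝ) = ((2 * x) ^ n / s) ^ 2 := by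
    rw [hss, div_pow, ← pow_mul, mul_comm n 2, pow_mul]; congr 2; ring
  have e2 : x ^ n / s = (1 / 2 : ℝ) ^ n * ((2 * x) ^ n / s) := by
    rw [← mul_div_assoc, ← mul_pow]; congr 2; ring
  rw [e, e2]
  have a1 : (0 : ℝ) ≤ (1 / 2 : ℝ) ^ n := by positivity
  have a2 : (1 / 2 : ℝ) ^ n ≤ 1 := pow_le_one₀ (by norm_num) (by norm_num)
  have a3 : 0 ≤ (2 * x) ^ n / s := by positivity
  nlinarith [sq_nonneg ((1 / 2 : ℝ) ^ n - ((2 * x) ^ n / s)), mul_nonneg a1 a3,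
    mul_nonneg a1 (sub_nonneg.2 a2)]

/-- The weights that turn coefficients of at most geometric growth, normalised by `√(n!)`, into an
everywhere absolutely convergent power series. -/
theorem summable_prod_pow_div_sqrt {d : ℕ} (z : Fin d → ℂ) (R : ℝ) (hR : 0 ≤ R) :
    Summable fun n : Fin d → ℕ =>
      ‖(∏ j, z j ^ n j) / (Real.sqrt (multiFactorial n) : ℂ)‖ * R ^ ∑ j, n j := by
  have hs : ∀ j, Summable fun k : ℕ => ‖((‖z j‖ * R : ℝ) : ℂ) ^ k / (Real.sqrt k.factorial : ℂ)‖ := by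
    intro j
    refine (summable_pow_div_sqrt_factorial (‖z j‖ * R) (by positivity)).congr fun k => ?_
    rw [norm_div, norm_pow, Complex.norm_real, Complex.norm_real, Real.norm_of_nonneg (by positivity),
      Real.norm_of_nonneg (Real.sqrt_nonneg _)]
  refine ((hasSum_pi_prod _ _ hs fun j => (Summable.of_norm (hs j)).hasSum).1).congr fun n => ?_
  rw [norm_div, norm_prod, norm_prod, Complex.norm_real, prod_sqrt_factorial,
    Real.norm_of_nonneg (Finset.prod_nonneg fun _ _ => Real.sqrt_nonneg _),
    ← Finset.prod_pow_eq_pow_sum, div_mul_eq_mul_div, ← Finset.prod_mul_distrib,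
    ← Finset.prod_div_distrib]
  refine Finset.prod_congr rfl fun j _ => ?_
  rw [norm_div, norm_pow, Complex.norm_real, Complex.norm_real, norm_pow,
    Real.norm_of_nonneg (by positivity), Real.norm_of_nonneg (Real.sqrt_nonneg _), mul_pow]

/-- A power series in several variables that vanishes on the unit torus is zero: its coefficients
are the Fourier coefficients of the function that it represents on the torus. -/
theorem coeff_eq_zero_of_hasSum_zero {d : ℕ} (a : (Fin d → ℕ) → ℂ)
    (ha : ∀ z : Fin d → ℂ, HasSum (fun n => a n * ∏ j, z j ^ n j) 0) : a = 0 := by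
  have hsum : Summable fun n => ‖a n‖ := by
    have := (ha fun _ => 1).summable.norm
    simpa using this
  let F : (Fin d → ℕ) → C(UnitAddTorus (Fin d), ℂ) := fun n =>
    a n • UnitAddTorus.mFourier fun j => (n j : ℤ)
  -- Mathlib's multivariate Fourier monomials refer to this choice of the measure on the circle.
  let : MeasureSpace UnitAddCircle := ⟨AddCircle.haarAddCircle⟩
  have : IsProbabilityMeasure (volume : Measure UnitAddCircle) :=
    inferInstanceAs (IsProbabilityMeasure AddCircle.haarAddCircle)
  have hF : Summable F := Summable.of_norm (by
    simpa only [F, norm_smul, UnitAddTorus.mFourier_norm, mul_one] using hsum)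
  have h0 : HasSum F 0 := by
    have h1 := hF.hasSum
    have : ∑' n, F n = 0 := by
      ext x
      refine (ContinuousMap.hasSum_apply h1 x).unique ?_
      have := ha fun j => fourier 1 (x j)
      refine this.congr_fun ?_
      intro n
      simp [F, UnitAddTorus.mFourier, fourier_apply, natCast_zsmul, AddCircle.toCircle_nsmul]
    rwa [this] at h1
  funext k
  have h2 := h0.mapL ((innerSL ℂ (UnitAddTorus.mFourierLp (d := Fin d) 2 fun j => (k j : ℤ))).comp
    (ContinuousMap.toLp (E := ℂ) 2 (volume : Measure (UnitAddTorus (Fin d))) ℂ))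
  have h3 := orthonormal_iff_ite.1 (UnitAddTorus.orthonormal_mFourier (d := Fin d))
    (fun j => (k j : ℤ))
  have h4 : HasSum (fun n => if n = k then a k else 0) 0 := by
    simp only [map_zero] at h2
    refine h2.congr_fun fun n => ?_
    simp only [F, map_smul, ContinuousLinearMap.comp_apply, innerSL_apply_apply, h3, smul_eq_mul]
    by_cases hnk : n = k
    · simp [hnk]
    · have : ¬ ((fun j => (k j : ℤ)) = fun j => (n j : ℤ)) := by
        intro h
        exact hnk (funext fun j => by have := congrFun h j; simp at this; exact this.symm)
      simp [hnk, this]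
  exact (hasSum_ite_eq k (a k)).unique h4

/-- Uniqueness of the coefficients of an everywhere convergent power series. -/
theorem coeff_unique {d : ℕ} (a b : (Fin d → ℕ) → ℂ) (F : (Fin d → ℂ) → ℂ)
    (ha : ∀ z : Fin d → ℂ, HasSum (fun n => a n * ∏ j, z j ^ n j) (F z))
    (hb : ∀ z : Fin d → ℂ, HasSum (fun n => b n * ∏ j, z j ^ n j) (F z)) : a = b := by
  refine sub_eq_zero.1 (coeff_eq_zero_of_hasSum_zero (a - b) fun z => ?_)
  have := (ha z).sub (hb z)
  rw [sub_self] at this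
  refine this.congr_fun fun n => ?_
  simp [sub_mul]

/-! ### Series and characters in `L²` -/

/-- A pointwise convergent series that is dominated by `c i * F` with `c` summable and `F ∈ L²`
converges unconditionally in `L²`. -/
theorem hasSum_toLp_of_dominated {α ι : Type*} [MeasurableSpace α] {μ : Measure α}
    (u : ι → α → ℂ) (g : α → ℂ) (F : α → ℝ) (c : ι → ℝ) (hu : ∀ i, MemLp (u i) 2 μ)
    (hg : MemLp g 2 μ) (hF : MemLp F 2 μ) (hF0 : ∀ x, 0 ≤ F x) (hc : Summable c)
    (hb : ∀ i x, ‖u i x‖ ≤ c i * F x) (hs : ∀ x, HasSum (fun i => u i x) (g x)) :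
    HasSum (fun i => (hu i).toLp (u i)) (hg.toLp g) := by
  have h1 : ∀ s : Finset ι, ∀ x, ‖(∑ i ∈ s, u i x) - g x‖ ≤ ((∑' i, c i) - ∑ i ∈ s, c i) * F x := by
    intro s x
    have hcF : Summable fun i => c i * F x := hc.mul_right _
    have h2 : HasSum (fun i : {i // i ∉ s} => u i x) (g x - ∑ i ∈ s, u i x) := by
      rw [← (hs x).tsum_eq, ← (hs x).summable.sum_add_tsum_compl (s := s), add_sub_cancel_left]
      exact ((hs x).summable.subtype _).hasSum
    have h3 : HasSum (fun i : {i // i ∉ s} => c i * F x) (((∑' i, c i) - ∑ i ∈ s, c i) * F x) := by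
      rw [← hc.sum_add_tsum_compl (s := s), add_sub_cancel_left, ← tsum_mul_right]
      exact (hcF.subtype _).hasSum
    rw [norm_sub_rev, ← h2.tsum_eq]
    exact tsum_of_norm_bounded h3 fun i => hb i x
  have hsum : ∀ s : Finset ι, ∑ i ∈ s, (hu i).toLp (u i) =
      (memLp_finsetSum s fun i _ => hu i).toLp (fun x => ∑ i ∈ s, u i x) := by
    intro s
    refine Lp.ext ?_
    refine (Lp.coeFn_finsetSum _ _).trans ?_
    refine EventuallyEq.trans ?_ (MemLp.coeFn_toLp _).symm
    have : ∀ᵐ x ∂μ, ∀ i ∈ s, (hu i).toLp (u i) x = u i x := by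
      exact (Filter.eventually_all_finset s).2 fun i _ => (hu i).coeFn_toLp
    filter_upwards [this] with x hx
    rw [Finset.sum_apply]
    exact Finset.sum_congr rfl hx
  rw [HasSum, SummationFilter.unconditional_filter, tendsto_iff_norm_sub_tendsto_zero]
  have hlim : Tendsto (fun s : Finset ι => ((∑' i, c i) - ∑ i ∈ s, c i) * ‖hF.toLp F‖) atTop (𝓝 0) := by
    have := (hc.hasSum.const_sub (∑' i, c i)).mul_const ‖hF.toLp F‖
    simpa using this
  refine squeeze_zero (fun _ => norm_nonneg _) (fun s => ?_) hlim
  refine Lp.norm_le_mul_norm_of_ae_le_mul ?_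
  rw [hsum s]
  filter_upwards [Lp.coeFn_sub ((memLp_finsetSum s fun i _ => hu i).toLp fun x => ∑ i ∈ s, u i x)
    (hg.toLp g), (memLp_finsetSum s fun i _ => hu i).coeFn_toLp, hg.coeFn_toLp, hF.coeFn_toLp]
    with x a1 a2 a3 a4
  rw [a1, Pi.sub_apply, a2, a3, a4, Real.norm_of_nonneg (hF0 x)]
  exact h1 s x

section Characters

variable {E : Type*} [NormedAddCommGroup E] [InnerProductSpace ℝ E] [MeasurableSpace E]
  [BorelSpace E] [SecondCountableTopology E] {μ : Measure E}

theorem memLp_character [IsFiniteMeasure μ] (ξ : E) :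
    MemLp (fun x => Complex.exp (inner ℝ x ξ * Complex.I)) 2 μ :=
  MemLp.of_bound (by fun_prop) 1 (ae_of_all _ fun x => (Complex.norm_exp_ofReal_mul_I _).le)

variable [CompleteSpace E]

/-- An integrable function is determined by its Fourier transform: compare the characteristic
functions of the measures whose densities are its positive and negative parts. -/
theorem ae_eq_zero_of_fourier_real {g : E → ℝ} (hg : Integrable g μ)
    (h : ∀ ξ : E, ∫ x, Complex.exp (inner ℝ x ξ * Complex.I) * (g x : ℂ) ∂μ = 0) : g =ᵐ[μ] 0 := by
  have key : ∀ {f : E → ℝ}, Integrable f μ → ∀ ξ,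
      charFun (μ.withDensity fun x => ENNReal.ofReal (f x)) ξ =
        ∫ x, Complex.exp (inner ℝ x ξ * Complex.I) * (max (f x) 0 : ℝ) ∂μ := by
    intro f hf ξ
    rw [charFun_apply, integral_withDensity_eq_integral_toReal_smul₀ hf.1.aemeasurable.ennreal_ofReal
      (ae_of_all _ fun x => ENNReal.ofReal_lt_top)]
    refine integral_congr_ae (ae_of_all _ fun x => ?_)
    simp only [ENNReal.toReal_ofReal', Complex.real_smul, mul_comm]
  have hfin : ∀ {f : E → ℝ}, Integrable f μ → ∫⁻ x, ENNReal.ofReal (f x) ∂μ ≠ ⊤ :=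
    fun hf => hf.lintegral_lt_top.ne
  have hint : ∀ {f : E → ℝ}, Integrable f μ → ∀ ξ,
      Integrable (fun x => Complex.exp (inner ℝ x ξ * Complex.I) * (max (f x) 0 : ℝ)) μ := by
    intro f hf ξ
    refine hf.pos_part.ofReal.bdd_mul (c := 1) (by fun_prop) (ae_of_all _ fun x => ?_)
    exact (Complex.norm_exp_ofReal_mul_I _).le
  have : IsFiniteMeasure (μ.withDensity fun x => ENNReal.ofReal (g x)) :=
    isFiniteMeasure_withDensity (hfin hg)
  have : IsFiniteMeasure (μ.withDensity fun x => ENNReal.ofReal (-g x)) :=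
    isFiniteMeasure_withDensity (hfin hg.neg)
  have heq : (μ.withDensity fun x => ENNReal.ofReal (g x)) =
      μ.withDensity fun x => ENNReal.ofReal (-g x) := by
    refine Measure.ext_of_charFun (funext fun ξ => ?_)
    rw [key hg, key (f := fun x => -g x) hg.neg, ← sub_eq_zero,
      ← integral_sub (hint hg ξ) (hint (f := fun x => -g x) hg.neg ξ), ← h ξ]
    refine integral_congr_ae (ae_of_all _ fun x => ?_)
    simp only [← mul_sub, ← Complex.ofReal_sub]
    rw [max_zero_sub_max_neg_zero_eq_self]
  have heq' := (withDensity_eq_iff hg.1.aemeasurable.ennreal_ofReal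
    (g := fun x => ENNReal.ofReal (-g x)) hg.1.aemeasurable.neg.ennreal_ofReal (hfin hg)).1 heq
  filter_upwards [heq'] with x hx
  rcases le_total (g x) 0 with h0 | h0
  · rw [ENNReal.ofReal_of_nonpos h0, eq_comm, ENNReal.ofReal_eq_zero] at hx
    simp only [Pi.zero_apply]; linarith
  · rw [ENNReal.ofReal_of_nonpos (neg_nonpos.2 h0), ENNReal.ofReal_eq_zero] at hx
    simp only [Pi.zero_apply]; linarith

/-- The complex case follows since the hypothesis is stable under complex conjugation of `g`. -/
theorem ae_eq_zero_of_fourier {g : E → ℂ} (hg : Integrable g μ)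
    (h : ∀ ξ : E, ∫ x, Complex.exp (inner ℝ x ξ * Complex.I) * g x ∂μ = 0) : g =ᵐ[μ] 0 := by
  have hconj : ∀ ξ : E, ∫ x, Complex.exp (inner ℝ x ξ * Complex.I) * (starRingEnd ℂ) (g x) ∂μ = 0 := by
    intro ξ
    have := congrArg (starRingEnd ℂ) (h (-ξ))
    rw [← integral_conj, map_zero] at this
    rw [← this]
    refine integral_congr_ae (ae_of_all _ fun x => ?_)
    simp [← Complex.exp_conj]
  have hint : ∀ ξ : E, ∀ {f : E → ℂ}, Integrable f μ →
      Integrable (fun x => Complex.exp (inner ℝ x ξ * Complex.I) * f x) μ := by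
    intro ξ f hf
    exact hf.bdd_mul (c := 1) (by fun_prop) (ae_of_all _ fun x => (Complex.norm_exp_ofReal_mul_I _).le)
  have hgc : Integrable (fun x => (starRingEnd ℂ) (g x)) μ :=
    (LinearIsometryEquiv.integrable_comp_iff Complex.conjLIE).2 hg
  have hre : (fun x => (g x).re) =ᵐ[μ] 0 := by
    refine ae_eq_zero_of_fourier_real hg.re fun ξ => ?_
    have e : ∀ x, Complex.exp (inner ℝ x ξ * Complex.I) * ((g x).re : ℂ) =
        (1 / 2) * (Complex.exp (inner ℝ x ξ * Complex.I) * g x +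
          Complex.exp (inner ℝ x ξ * Complex.I) * (starRingEnd ℂ) (g x)) := by
      intro x; rw [Complex.re_eq_add_conj]; ring
    change ∫ x, Complex.exp (inner ℝ x ξ * Complex.I) * ((g x).re : ℂ) ∂μ = 0
    simp_rw [e]
    rw [integral_const_mul, integral_add (hint ξ hg) (hint ξ hgc), h, hconj]
    simp
  have him : (fun x => (g x).im) =ᵐ[μ] 0 := by
    refine ae_eq_zero_of_fourier_real hg.im fun ξ => ?_
    have e : ∀ x, Complex.exp (inner ℝ x ξ * Complex.I) * ((g x).im : ℂ) =
        (1 / (2 * Complex.I)) * (Complex.exp (inner ℝ x ξ * Complex.I) * g x -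
          Complex.exp (inner ℝ x ξ * Complex.I) * (starRingEnd ℂ) (g x)) := by
      intro x; rw [Complex.im_eq_sub_conj]; ring
    change ∫ x, Complex.exp (inner ℝ x ξ * Complex.I) * ((g x).im : ℂ) ∂μ = 0
    simp_rw [e]
    rw [integral_const_mul, integral_sub (hint ξ hg) (hint ξ hgc), h, hconj]
    simp
  filter_upwards [hre, him] with x h1 h2
  exact Complex.ext h1 h2

/-- Characters are total in `L²` of a finite measure: their orthogonal complement is trivial by
injectivity of the Fourier transform. -/
theorem dense_span_characters [IsFiniteMeasure μ] :
    Dense (Submodule.span ℂ (Set.range fun ξ : E => (memLp_character (μ := μ) ξ).toLp _) :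
      Set (Lp ℂ 2 μ)) := by
  rw [Submodule.dense_iff_topologicalClosure_eq_top, Submodule.topologicalClosure_eq_top_iff,
    Submodule.eq_bot_iff]
  intro g hg
  refine (Lp.eq_zero_iff_ae_eq_zero).2 ?_
  refine ae_eq_zero_of_fourier ((Lp.memLp g).integrable (by norm_num)) fun ξ => ?_
  have h1 := (Submodule.mem_orthogonal _ _).1 hg _ (Submodule.subset_span ⟨-ξ, rfl⟩)
  rw [L2.inner_def] at h1
  rw [← h1]
  refine integral_congr_ae ?_
  filter_upwards [(memLp_character (μ := μ) (-ξ)).coeFn_toLp] with x hx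
  rw [hx, RCLike.inner_apply]
  simp [← Complex.exp_conj, mul_comm]

end Characters

/-! ### Markov kernels as contractions of `L²` of an invariant measure -/

section Kernel

theorem ae_integrable_kernel {α : Type*} [MeasurableSpace α] {μ : Measure α} {κ : Kernel α α}
    [IsFiniteMeasure μ] (hinv : μ.bind κ = μ) {f : α → ℂ} (hf : MemLp f 2 μ) :
    ∀ᵐ x ∂μ, Integrable f (κ x) := by
  refine Measure.ae_integrable_of_integrable_comp ?_
  rw [hinv]
  exact hf.integrable (by norm_num)

variable {α : Type*} [MeasurableSpace α] {μ : Measure α} {κ : Kernel α α} [IsMarkovKernel κ]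

/-- Jensen's inequality on each fibre, integrated against the invariant measure. -/
theorem eLpNorm_integral_kernel_le (hinv : μ.bind κ = μ) {f : α → ℂ}
    (hf : AEStronglyMeasurable f μ) :
    eLpNorm (fun x => ∫ y, f y ∂κ x) 2 μ ≤ eLpNorm f 2 μ := by
  have hae : ∀ᵐ x ∂μ, AEStronglyMeasurable f (κ x) := by
    rw [← hinv] at hf
    filter_upwards [Measure.ae_ae_of_ae_comp hf.ae_eq_mk] with x hx
    exact ⟨hf.mk f, hf.stronglyMeasurable_mk, hx⟩
  have hsq : ∀ (ν : Measure α) (g : α → ℂ),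
      eLpNorm g 2 ν = (∫⁻ x, ‖g x‖ₑ ^ (2 : ℝ) ∂ν) ^ (1 / 2 : ℝ) := by
    intro ν g
    rw [eLpNorm_eq_lintegral_rpow_enorm_toReal (by norm_num) (by norm_num)]
    simp
  have h1 : ∫⁻ x, ‖f x‖ₑ ^ (2 : ℝ) ∂μ = ∫⁻ x, ∫⁻ y, ‖f y‖ₑ ^ (2 : ℝ) ∂κ x ∂μ := by
    conv_lhs => rw [← hinv]
    refine Measure.lintegral_bind κ.measurable.aemeasurable ?_
    rw [hinv]
    exact hf.enorm.pow_const _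
  rw [hsq, hsq, h1]
  refine ENNReal.rpow_le_rpow (lintegral_mono_ae ?_) (by norm_num)
  filter_upwards [hae] with x hx
  have h2 : ‖∫ y, f y ∂κ x‖ₑ ≤ eLpNorm f 2 (κ x) := by
    refine (enorm_integral_le_lintegral_enorm _).trans ?_
    rw [← eLpNorm_one_eq_lintegral_enorm]
    exact eLpNorm_le_eLpNorm_of_exponent_le (by norm_num) hx
  calc ‖∫ y, f y ∂κ x‖ₑ ^ (2 : ℝ) ≤ eLpNorm f 2 (κ x) ^ (2 : ℝ) :=
        ENNReal.rpow_le_rpow h2 (by norm_num)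
    _ = _ := by rw [hsq, ← ENNReal.rpow_mul]; norm_num

theorem memLp_integral_kernel (hinv : μ.bind κ = μ) {f : α → ℂ} (hf : MemLp f 2 μ) :
    MemLp (fun x => ∫ y, f y ∂κ x) 2 μ := by
  refine ⟨?_, (eLpNorm_integral_kernel_le hinv hf.1).trans_lt hf.2⟩
  have h := hf.1
  rw [← hinv] at h
  exact ⟨fun x => ∫ y, h.mk f y ∂κ x, h.stronglyMeasurable_mk.integral_kernel, by
    filter_upwards [Measure.ae_ae_of_ae_comp h.ae_eq_mk] with _ hx using integral_congr_ae hx⟩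

/-- A Markov kernel acts on `L²` of an invariant measure as a bounded operator. -/
theorem exists_continuousLinearMap_kernel [IsFiniteMeasure μ] (hinv : μ.bind κ = μ) :
    ∃ P : Lp ℂ 2 μ →L[ℂ] Lp ℂ 2 μ, ∀ f (hf : MemLp f 2 μ),
      P (hf.toLp f) = (memLp_integral_kernel hinv hf).toLp _ := by
  have hcongr : ∀ {f g : α → ℂ}, f =ᵐ[μ] g →
      (fun x => ∫ y, f y ∂κ x) =ᵐ[μ] fun x => ∫ y, g y ∂κ x := by
    intro f g h
    rw [← hinv] at h
    have := Measure.ae_ae_of_ae_comp h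
    filter_upwards [this] with x hx using integral_congr_ae hx
  let P₀ : Lp ℂ 2 μ →ₗ[ℂ] Lp ℂ 2 μ :=
    { toFun := fun f => (memLp_integral_kernel hinv (Lp.memLp f)).toLp _
      map_add' := by
        intro f g
        rw [← MemLp.toLp_add]
        refine MemLp.toLp_congr _ _ ((hcongr (Lp.coeFn_add f g)).trans ?_)
        filter_upwards [ae_integrable_kernel hinv (Lp.memLp f),
          ae_integrable_kernel hinv (Lp.memLp g)] with x hf hg
        exact integral_add hf hg
      map_smul' := by
        intro c f
        rw [RingHom.id_apply, ← MemLp.toLp_const_smul]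
        refine MemLp.toLp_congr _ _ ((hcongr (Lp.coeFn_smul c f)).trans ?_)
        exact ae_of_all _ fun x => integral_smul c _ }
  refine ⟨P₀.mkContinuous 1 fun f => ?_, fun f hf => ?_⟩
  · change ‖(memLp_integral_kernel hinv (Lp.memLp f)).toLp _‖ ≤ _
    rw [Lp.norm_toLp, one_mul, Lp.norm_def]
    exact ENNReal.toReal_mono (Lp.eLpNorm_ne_top f) (eLpNorm_integral_kernel_le hinv (Lp.memLp f).1)
  · exact MemLp.toLp_congr (memLp_integral_kernel hinv (Lp.memLp _)) _ (hcongr hf.coeFn_toLp)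

end Kernel

section

open Matrix

variable {d : ℕ}

/-! ### Complex exponential moments of Gaussian measures -/

/-- The complex bilinear (not sesquilinear) extension of the form with real matrix `A`. -/
noncomputable def cform (A : Matrix (Fin d) (Fin d) ℝ) (z w : Fin d → ℂ) : ℂ :=
  z ⬝ᵥ A.map Complex.ofRealHom *ᵥ w

theorem cform_vecMul (Q T K : Matrix (Fin d) (Fin d) ℝ) (z w : Fin d → ℂ) :
    cform Q (z ᵥ* T.map Complex.ofRealHom) (w ᵥ* K.map Complex.ofRealHom) =
      cform (T * Q * Kᵀ) z w := by
  simp only [cform, Matrix.map_mul, Matrix.transpose_map, ← Matrix.mulVec_mulVec]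
  rw [Matrix.mulVec_transpose, Matrix.dotProduct_mulVec z]

theorem cform_add_add (A : Matrix (Fin d) (Fin d) ℝ) (a b : Fin d → ℂ) :
    cform A (a + b) (a + b) = cform A a a + cform A a b + cform A b a + cform A b b := by
  simp only [cform, Matrix.mulVec_add, add_dotProduct, dotProduct_add]; ring

theorem cform_one (z w : Fin d → ℂ) : cform 1 z w = z ⬝ᵥ w := by
  simp [cform]

theorem cform_smul_smul (A : Matrix (Fin d) (Fin d) ℝ) (c : ℂ) (z w : Fin d → ℂ) :
    cform A (c • z) (c • w) = c ^ 2 * cform A z w := by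
  simp [cform, Matrix.mulVec_smul, smul_dotProduct, dotProduct_smul]; ring

theorem cform_ofReal (A : Matrix (Fin d) (Fin d) ℝ) (x y : Fin d → ℝ) :
    cform A (fun j => (x j : ℂ)) (fun j => (y j : ℂ)) = ((x ⬝ᵥ A *ᵥ y : ℝ) : ℂ) := by
  simp [cform, dotProduct, Matrix.mulVec]

theorem integral_cexp_stdGaussian (b : Fin d → ℂ) :
    ∫ x, Complex.exp (∑ j, b j * (x j : ℂ)) ∂(stdGaussian (EuclideanSpace ℝ (Fin d))) =
      Complex.exp (1 / 2 * ∑ j, b j ^ 2) := by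
  rw [← map_pi_eq_stdGaussian, integral_map (by fun_prop) (by fun_prop)]
  simp_rw [Complex.exp_sum]
  rw [integral_fintype_prod_eq_prod (f := fun j (x : ℝ) => Complex.exp (b j * (x : ℂ))),
    Finset.mul_sum, Complex.exp_sum]
  refine Finset.prod_congr rfl fun j _ => ?_
  have := complexMGF_gaussianReal (p := gaussianReal 0 1) (X := id) (μ := 0) (v := 1)
    (by simp) (b j)
  simp only [complexMGF, id] at this
  rw [this]
  congr 1; simp; ring

theorem exists_sq_of_posSemidef {A : Matrix (Fin d) (Fin d) ℝ} (hA : A.PosSemidef) :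
    ∃ R : Matrix (Fin d) (Fin d) ℝ, R * Rᵀ = A ∧ Rᵀ = R ∧ ∀ m : EuclideanSpace ℝ (Fin d),
      multivariateGaussian m A = (stdGaussian (EuclideanSpace ℝ (Fin d))).map
        (fun x => m + Matrix.toEuclideanCLM (𝕜 := ℝ) R x) := by
  open scoped MatrixOrder in
  refine ⟨CFC.sqrt A, ?_, ?_, fun m => rfl⟩
  all_goals
    have h : (CFC.sqrt A).PosSemidef := Matrix.nonneg_iff_posSemidef.1 (CFC.sqrt_nonneg A)
    have h2 := h.isHermitian.eq
    rw [Matrix.conjTranspose_eq_transpose_of_trivial] at h2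
  · rw [h2, CFC.sqrt_mul_sqrt_self _ hA.nonneg]
  · exact h2

/-- Exponential moments of a centred Gaussian at complex arguments. -/
theorem integral_cexp_gaussian {A : Matrix (Fin d) (Fin d) ℝ} (hA : A.PosSemidef)
    (a : Fin d → ℂ) :
    ∫ x, Complex.exp (∑ j, a j * (x j : ℂ)) ∂(multivariateGaussian 0 A) =
      Complex.exp (1 / 2 * cform A a a) := by
  obtain ⟨R, hR, hRs, hm⟩ := exists_sq_of_posSemidef hA
  rw [hm, integral_map (by fun_prop) (by fun_prop)]
  have e : ∀ x : EuclideanSpace ℝ (Fin d),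
      ∑ j, a j * (((0 + Matrix.toEuclideanCLM (𝕜 := ℝ) R x) j : ℝ) : ℂ) =
        ∑ k, (a ᵥ* R.map Complex.ofRealHom) k * (x k : ℂ) := by
    intro x
    have : ∀ j, (((0 + Matrix.toEuclideanCLM (𝕜 := ℝ) R x) j : ℝ) : ℂ) =
        (R.map Complex.ofRealHom *ᵥ fun k => (x k : ℂ)) j := by
      intro j; simp [Matrix.mulVec, dotProduct]
    simp_rw [this]
    exact Matrix.dotProduct_mulVec a _ _
  simp_rw [e]
  rw [integral_cexp_stdGaussian]
  have h1 : ∑ k, (a ᵥ* R.map Complex.ofRealHom) k ^ 2 = cform A a a := by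
    have := cform_vecMul 1 R R a a
    rw [Matrix.mul_one, hR, cform_one] at this
    rw [← this]
    simp [dotProduct, sq]
  rw [h1]

theorem exists_integrable_exp_sq_gaussian (m : EuclideanSpace ℝ (Fin d))
    (A : Matrix (Fin d) (Fin d) ℝ) :
    ∃ C : ℝ, 0 < C ∧ ∀ c ≤ C, Integrable (fun x => Real.exp (c * ‖x‖ ^ 2))
      (multivariateGaussian m A) := by
  obtain ⟨C, hC, hi⟩ := IsGaussian.exists_integrable_exp_sq (multivariateGaussian m A)
  refine ⟨C, hC, fun c hc => hi.mono' (by fun_prop) (ae_of_all _ fun x => ?_)⟩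
  rw [Real.norm_of_nonneg (Real.exp_pos _).le]
  exact Real.exp_le_exp.2 (by gcongr)

/-- A linear exponent is dominated by an arbitrarily small quadratic one. -/
theorem exp_linear_le {ε c : ℝ} (hε : 0 < ε) (t : ℝ) :
    Real.exp (c * t) ≤ Real.exp (c ^ 2 / (4 * ε)) * Real.exp (ε * t ^ 2) := by
  rw [← Real.exp_add]
  refine Real.exp_le_exp.2 ?_
  have : c ^ 2 / (4 * ε) + ε * t ^ 2 - c * t = (c - 2 * ε * t) ^ 2 / (4 * ε) := by
    field_simp; ring
  have h2 : 0 ≤ (c - 2 * ε * t) ^ 2 / (4 * ε) := by positivity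
  linarith

theorem abs_coord_le_norm (x : EuclideanSpace ℝ (Fin d)) (j : Fin d) : |x j| ≤ ‖x‖ :=
  PiLp.norm_apply_le x j

/-! ### The Hermite family of a Gaussian covariance -/

/-- The normalised Hermite polynomial of covariance `A`, as the Gaussian average
`𝔼 ∏ⱼ (vⱼ + i Zⱼ) ^ nⱼ / √(n!)` with `Z ∼ N(0, A)`. It is real, but kept complex-valued. -/
noncomputable def gaussHermite (A : Matrix (Fin d) (Fin d) ℝ) (n : Fin d → ℕ) (v : Fin d → ℝ) :
    ℂ :=
  (∫ Z, ∏ j, ((v j : ℂ) + (Z j : ℂ) * Complex.I) ^ n j ∂(multivariateGaussian 0 A)) /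
    (Real.sqrt (multiFactorial n) : ℂ)

theorem pow_le_sqrt_factorial_mul_exp {r s : ℝ} (hr : 0 < r) (hs : 0 ≤ s) (k : ℕ) :
    s ^ k ≤ Real.sqrt k.factorial * (r⁻¹ ^ k * Real.exp (r ^ 2 / 2 * s ^ 2)) := by
  have h1 := Real.pow_div_factorial_le_exp (r ^ 2 * s ^ 2) (by positivity) k
  rw [div_le_iff₀ (by positivity)] at h1
  have h2 : (r * s) ^ k ≤ Real.sqrt k.factorial * Real.exp (r ^ 2 / 2 * s ^ 2) := by
    refine (sq_le_sq₀ (by positivity) (by positivity)).1 ?_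
    rw [mul_pow (Real.sqrt _), Real.sq_sqrt (by positivity), ← Real.exp_nat_mul]
    calc ((r * s) ^ k) ^ 2 = (r ^ 2 * s ^ 2) ^ k := by ring
      _ ≤ _ := h1
      _ = _ := by rw [mul_comm]; congr 2; push_cast; ring
  calc s ^ k = r⁻¹ ^ k * (r * s) ^ k := by
        rw [← mul_pow]; congr 1; field_simp
    _ ≤ r⁻¹ ^ k * (Real.sqrt k.factorial * Real.exp (r ^ 2 / 2 * s ^ 2)) := by gcongr
    _ = _ := by ring

/-- The scale `r` is free: a small `r` buys a small square-exponential rate at the price of geometric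
growth in the order `|n|`. -/
theorem norm_prod_pow_le {r : ℝ} (hr : 0 < r) (n : Fin d → ℕ) (v : Fin d → ℝ)
    (Z : EuclideanSpace ℝ (Fin d)) :
    ‖∏ j, ((v j : ℂ) + (Z j : ℂ) * Complex.I) ^ n j‖ ≤ Real.sqrt (multiFactorial n) *
      (r⁻¹ ^ (∑ j, n j) * (Real.exp (r ^ 2 / 2 * ∑ j, v j ^ 2) *
        Real.exp (r ^ 2 / 2 * ‖Z‖ ^ 2))) := by
  rw [norm_prod, prod_sqrt_factorial, ← Finset.prod_pow_eq_pow_sum, ← Real.exp_add, ← mul_add,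
    EuclideanSpace.real_norm_sq_eq, ← Finset.sum_add_distrib, Finset.mul_sum, Real.exp_sum,
    ← Finset.prod_mul_distrib, ← Finset.prod_mul_distrib]
  refine Finset.prod_le_prod (fun _ _ => norm_nonneg _) fun j _ => ?_
  have h : ‖(v j : ℂ) + (Z j : ℂ) * Complex.I‖ ^ 2 = v j ^ 2 + Z j ^ 2 := by
    rw [← Complex.normSq_eq_norm_sq, Complex.normSq_add_mul_I]
  rw [norm_pow, ← h]
  exact pow_le_sqrt_factorial_mul_exp hr (norm_nonneg _) _

theorem exists_norm_gaussHermite_le (A : Matrix (Fin d) (Fin d) ℝ) {ε : ℝ} (hε : 0 < ε) :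
    ∃ K R : ℝ, 0 ≤ K ∧ 1 ≤ R ∧ ∀ n v,
      ‖gaussHermite A n v‖ ≤ K * R ^ (∑ j, n j) * Real.exp (ε * ∑ j, v j ^ 2) := by
  obtain ⟨C, hC, hi⟩ := exists_integrable_exp_sq_gaussian 0 A
  obtain ⟨r, hr, hr1, hrC, hrε⟩ : ∃ r : ℝ, 0 < r ∧ r ≤ 1 ∧ r ^ 2 / 2 ≤ C ∧ r ^ 2 / 2 ≤ ε := by
    refine ⟨min 1 (min C ε), by positivity, min_le_left _ _, ?_, ?_⟩
    all_goals
      have h0 : 0 < min 1 (min C ε) := by positivity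
      have h1 : min 1 (min C ε) ≤ 1 := min_le_left _ _
      have h2 : min 1 (min C ε) ≤ C := (min_le_right _ _).trans (min_le_left _ _)
      have h3 : min 1 (min C ε) ≤ ε := (min_le_right _ _).trans (min_le_right _ _)
      nlinarith
  refine ⟨∫ Z, Real.exp (r ^ 2 / 2 * ‖Z‖ ^ 2) ∂(multivariateGaussian 0 A), r⁻¹,
    integral_nonneg fun _ => (Real.exp_pos _).le, (one_le_inv₀ hr).2 hr1, fun n v => ?_⟩
  have hs : 0 < Real.sqrt (multiFactorial n) := by
    rw [prod_sqrt_factorial]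
    exact Finset.prod_pos fun j _ => Real.sqrt_pos.2 (by positivity)
  rw [gaussHermite, norm_div, Complex.norm_real, Real.norm_of_nonneg hs.le, div_le_iff₀ hs]
  refine (norm_integral_le_of_norm_le (g := fun Z => Real.sqrt (multiFactorial n) *
      (r⁻¹ ^ (∑ j, n j) * (Real.exp (r ^ 2 / 2 * ∑ j, v j ^ 2) *
        Real.exp (r ^ 2 / 2 * ‖Z‖ ^ 2)))) (((hi _ hrC).const_mul _).const_mul _ |>.const_mul _)
      (ae_of_all _ fun Z => norm_prod_pow_le hr n v Z)).trans ?_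
  simp_rw [integral_const_mul]
  have h0 : 0 ≤ ∫ Z, Real.exp (r ^ 2 / 2 * ‖Z‖ ^ 2) ∂(multivariateGaussian 0 A) :=
    integral_nonneg fun _ => (Real.exp_pos _).le
  have h1 : Real.exp (r ^ 2 / 2 * ∑ j, v j ^ 2) ≤ Real.exp (ε * ∑ j, v j ^ 2) :=
    Real.exp_le_exp.2 (mul_le_mul_of_nonneg_right hrε (Finset.sum_nonneg fun _ _ => sq_nonneg _))
  calc _ = (∫ Z, Real.exp (r ^ 2 / 2 * ‖Z‖ ^ 2) ∂(multivariateGaussian 0 A)) *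
        r⁻¹ ^ (∑ j, n j) * Real.exp (r ^ 2 / 2 * ∑ j, v j ^ 2) * Real.sqrt (multiFactorial n) := by
        ring
    _ ≤ _ := by gcongr

/-- The generating series: `exp ⟨z, v + i Z⟩` is expanded under the Gaussian expectation. -/
theorem hasSum_gaussHermite {A : Matrix (Fin d) (Fin d) ℝ} (hA : A.PosSemidef) (v : Fin d → ℝ)
    (z : Fin d → ℂ) :
    HasSum (fun n => gaussHermite A n v * ((∏ j, z j ^ n j) / (Real.sqrt (multiFactorial n) : ℂ)))
      (Complex.exp (∑ j, z j * (v j : ℂ) - 1 / 2 * cform A z z)) := by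
  obtain ⟨C, hC, hi⟩ := exists_integrable_exp_sq_gaussian 0 A
  set W : EuclideanSpace ℝ (Fin d) → Fin d → ℂ := fun Z j => (v j : ℂ) + (Z j : ℂ) * Complex.I
    with hW
  have hsum : ∀ Z, HasSum (fun n : Fin d → ℕ => ∏ j, (z j * W Z j) ^ n j / ((n j).factorial : ℂ))
      (Complex.exp (∑ j, z j * W Z j)) := fun Z => hasSum_exp_pi _
  have hsumn : ∀ Z, HasSum (fun n : Fin d → ℕ =>
      ‖∏ j, (z j * W Z j) ^ n j / ((n j).factorial : ℂ)‖) (Real.exp (∑ j, ‖z j * W Z j‖)) := by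
    intro Z
    have := hasSum_exp_pi fun j => ((‖z j * W Z j‖ : ℝ) : ℂ)
    rw [← Complex.ofReal_sum, ← Complex.ofReal_exp] at this
    rw [← Complex.hasSum_ofReal]
    refine this.congr_fun fun n => ?_
    push_cast [norm_prod, norm_div, norm_pow]
    simp
  have hdom : Integrable (fun Z => Real.exp (∑ j, ‖z j * W Z j‖)) (multivariateGaussian 0 A) := by
    refine ((hi C le_rfl).const_mul (Real.exp (∑ j, ‖z j‖ * |v j|) *
      Real.exp ((∑ j, ‖z j‖) ^ 2 / (4 * C)))).mono' (by fun_prop) (ae_of_all _ fun Z => ?_)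
    rw [Real.norm_of_nonneg (Real.exp_pos _).le, mul_assoc]
    refine le_trans ?_ (mul_le_mul_of_nonneg_left (exp_linear_le hC ‖Z‖) (Real.exp_pos _).le)
    rw [← Real.exp_add]
    refine Real.exp_le_exp.2 ?_
    rw [Finset.sum_mul, ← Finset.sum_add_distrib]
    refine Finset.sum_le_sum fun j _ => ?_
    rw [norm_mul, ← mul_add]
    refine mul_le_mul_of_nonneg_left ?_ (norm_nonneg _)
    refine (norm_add_le _ _).trans ?_
    rw [norm_mul, Complex.norm_I, mul_one, Complex.norm_real, Complex.norm_real]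
    exact add_le_add le_rfl (abs_coord_le_norm Z j)
  have hmain := hasSum_integral_of_dominated_convergence (μ := multivariateGaussian 0 A)
    (F := fun (n : Fin d → ℕ) Z => ∏ j, (z j * W Z j) ^ n j / ((n j).factorial : ℂ))
    (f := fun Z => Complex.exp (∑ j, z j * W Z j))
    (fun n Z => ‖∏ j, (z j * W Z j) ^ n j / ((n j).factorial : ℂ)‖)
    (fun n => by fun_prop) (fun n => ae_of_all _ fun Z => le_rfl)
    (ae_of_all _ fun Z => (hsumn Z).summable)
    (by simp_rw [fun Z => (hsumn Z).tsum_eq]; exact hdom) (ae_of_all _ hsum)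
  have hval : ∫ Z, Complex.exp (∑ j, z j * W Z j) ∂(multivariateGaussian 0 A) =
      Complex.exp (∑ j, z j * (v j : ℂ) - 1 / 2 * cform A z z) := by
    have e : ∀ Z : EuclideanSpace ℝ (Fin d), Complex.exp (∑ j, z j * W Z j) =
        Complex.exp (∑ j, z j * (v j : ℂ)) *
          Complex.exp (∑ j, (Complex.I • z) j * (Z j : ℂ)) := by
      intro Z
      rw [← Complex.exp_add, ← Finset.sum_add_distrib]
      congr 1
      refine Finset.sum_congr rfl fun j _ => ?_
      simp only [hW, Pi.smul_apply, smul_eq_mul]; ring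
    simp_rw [e]
    rw [integral_const_mul, integral_cexp_gaussian hA, ← Complex.exp_add, cform_smul_smul,
      Complex.I_sq]
    congr 1; ring
  rw [hval] at hmain
  refine hmain.congr_fun fun n => ?_
  have e : ∀ Z, ∏ j, (z j * W Z j) ^ n j / ((n j).factorial : ℂ) =
      ((∏ j, z j ^ n j) / ∏ j, ((n j).factorial : ℂ)) * ∏ j, W Z j ^ n j := by
    intro Z
    rw [← Finset.prod_div_distrib, ← Finset.prod_mul_distrib]
    refine Finset.prod_congr rfl fun j _ => ?_
    rw [mul_pow]; ring
  simp_rw [e]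
  rw [integral_const_mul, gaussHermite, ← sqrt_multiFactorial_mul_self]
  ring

/-! ### Mixed derivatives of Gaussian generating functions -/

/-- The Gaussian average `𝔼 ∏ⱼ Wⱼ ^ mⱼ · exp ⟨z, W⟩` with `W = v + i Z`, `Z ∼ N(0, A)`. -/
noncomputable def expMoment (A : Matrix (Fin d) (Fin d) ℝ) (v : Fin d → ℝ) (m : Fin d → ℕ)
    (z : EuclideanSpace ℝ (Fin d)) : ℂ :=
  ∫ Z, (∏ j, ((v j : ℂ) + (Z j : ℂ) * Complex.I) ^ m j) *
    Complex.exp (∑ k, (z k : ℂ) * ((v k : ℂ) + (Z k : ℂ) * Complex.I)) ∂(multivariateGaussian 0 A)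

theorem prod_pow_add_single (W : Fin d → ℂ) (m : Fin d → ℕ) (k : Fin d) :
    ∏ j, W j ^ (m + Pi.single k 1 : Fin d → ℕ) j = (∏ j, W j ^ m j) * W k := by
  simp_rw [Pi.add_apply, pow_add, Finset.prod_mul_distrib]
  congr 1
  rw [Finset.prod_eq_single k] <;> simp +contextual

theorem hasFDerivAt_expMoment (A : Matrix (Fin d) (Fin d) ℝ) (v : Fin d → ℝ) (m : Fin d → ℕ)
    (z₀ : EuclideanSpace ℝ (Fin d)) :
    ∃ F' : EuclideanSpace ℝ (Fin d) →L[ℝ] ℂ, HasFDerivAt (expMoment A v m) F' z₀ ∧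
      ∀ k, F' (EuclideanSpace.single k 1) = expMoment A v (m + Pi.single k 1) z₀ := by
  obtain ⟨C, hC, hi⟩ := exists_integrable_exp_sq_gaussian 0 A
  obtain ⟨r, hr, hrC⟩ : ∃ r : ℝ, 0 < r ∧ r ^ 2 / 2 ≤ C := by
    refine ⟨min 1 C, by positivity, ?_⟩
    have h0 : 0 < min 1 C := by positivity
    have h1 : min 1 C ≤ 1 := min_le_left _ _
    have h2 : min 1 C ≤ C := min_le_right _ _
    nlinarith
  set W : EuclideanSpace ℝ (Fin d) → Fin d → ℂ := fun Z j => (v j : ℂ) + (Z j : ℂ) * Complex.I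
    with hW
  set ℓ : Fin d → EuclideanSpace ℝ (Fin d) →L[ℝ] ℂ := fun k =>
    Complex.ofRealCLM.comp (EuclideanSpace.proj k)
  let F : EuclideanSpace ℝ (Fin d) → EuclideanSpace ℝ (Fin d) → ℂ := fun z Z =>
    (∏ j, W Z j ^ m j) * Complex.exp (∑ k, (z k : ℂ) * W Z k)
  let F' : EuclideanSpace ℝ (Fin d) → EuclideanSpace ℝ (Fin d) →
      EuclideanSpace ℝ (Fin d) →L[ℝ] ℂ := fun z Z =>
    ∑ k, ((∏ j, W Z j ^ (m + Pi.single k 1 : Fin d → ℕ) j) *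
      Complex.exp (∑ k, (z k : ℂ) * W Z k)) • ℓ k
  have hprod : ∀ n : Fin d → ℕ, ∃ c : ℝ, ∀ Z,
      ‖∏ j, W Z j ^ n j‖ ≤ c * Real.exp (r ^ 2 / 2 * ‖Z‖ ^ 2) := by
    intro n
    refine ⟨Real.sqrt (multiFactorial n) * (r⁻¹ ^ (∑ j, n j) *
      Real.exp (r ^ 2 / 2 * ∑ j, v j ^ 2)), fun Z => ?_⟩
    refine (norm_prod_pow_le hr n v Z).trans (le_of_eq ?_)
    ring
  choose c hc using hprod
  have hexp : ∀ z Z : EuclideanSpace ℝ (Fin d), ‖Complex.exp (∑ k, (z k : ℂ) * W Z k)‖ = Real.exp (∑ k, z k * v k) := by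
    intro z Z
    rw [Complex.norm_exp, Complex.re_sum]
    simp [hW]
  have hexp_le : ∀ z ∈ Metric.ball z₀ 1, ∀ Z, ‖Complex.exp (∑ k, (z k : ℂ) * W Z k)‖ ≤
      Real.exp (∑ k, (‖z₀‖ + 1) * |v k|) := by
    intro z hz Z
    rw [hexp]
    refine Real.exp_le_exp.2 (Finset.sum_le_sum fun k _ => ?_)
    refine (le_abs_self _).trans ?_
    rw [abs_mul]
    have h1 : ‖z‖ ≤ ‖z₀‖ + 1 := by
      have h2 := norm_le_norm_add_norm_sub' z z₀
      rw [Metric.mem_ball, dist_eq_norm] at hz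
      linarith
    exact mul_le_mul_of_nonneg_right ((abs_coord_le_norm z k).trans h1) (abs_nonneg _)
  have hF_le : ∀ n : Fin d → ℕ, ∀ z ∈ Metric.ball z₀ 1, ∀ Z,
      ‖(∏ j, W Z j ^ n j) * Complex.exp (∑ k, (z k : ℂ) * W Z k)‖ ≤
        c n * Real.exp (r ^ 2 / 2 * ‖Z‖ ^ 2) * Real.exp (∑ k, (‖z₀‖ + 1) * |v k|) := by
    intro n z hz Z
    rw [norm_mul]
    exact mul_le_mul (hc n Z) (hexp_le z hz Z) (norm_nonneg _) ((norm_nonneg _).trans (hc n Z))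
  have hint : ∀ n : Fin d → ℕ, Integrable (fun Z => c n * Real.exp (r ^ 2 / 2 * ‖Z‖ ^ 2) *
      Real.exp (∑ k, (‖z₀‖ + 1) * |v k|)) (multivariateGaussian 0 A) := fun n =>
    ((hi _ hrC).const_mul _).mul_const _
  have hmem : z₀ ∈ Metric.ball z₀ 1 := Metric.mem_ball_self one_pos
  have hintF : ∀ n : Fin d → ℕ, Integrable (fun Z => (∏ j, W Z j ^ n j) *
      Complex.exp (∑ k, (z₀ k : ℂ) * W Z k)) (multivariateGaussian 0 A) := fun n =>
    (hint n).mono' (by fun_prop) (ae_of_all _ fun Z => hF_le n z₀ hmem Z)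
  have hF'meas : ∀ z, AEStronglyMeasurable (F' z) (multivariateGaussian 0 A) := fun z => by
    refine Continuous.aestronglyMeasurable ?_
    fun_prop
  have hF'_le : ∀ z ∈ Metric.ball z₀ 1, ∀ Z, ‖F' z Z‖ ≤ ∑ k, (c (m + Pi.single k 1) *
      Real.exp (r ^ 2 / 2 * ‖Z‖ ^ 2) * Real.exp (∑ k, (‖z₀‖ + 1) * |v k|)) * ‖ℓ k‖ := by
    intro z hz Z
    refine (norm_sum_le _ _).trans (Finset.sum_le_sum fun k _ => ?_)
    rw [norm_smul]
    exact mul_le_mul_of_nonneg_right (hF_le _ z hz Z) (norm_nonneg _)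
  have hbound : Integrable (fun Z => ∑ k, (c (m + Pi.single k 1) *
      Real.exp (r ^ 2 / 2 * ‖Z‖ ^ 2) * Real.exp (∑ k, (‖z₀‖ + 1) * |v k|)) * ‖ℓ k‖)
      (multivariateGaussian 0 A) := integrable_finsetSum _ fun k _ => (hint _).mul_const _
  have hder := hasFDerivAt_integral_of_dominated_of_fderiv_le (μ := multivariateGaussian 0 A)
    (F := F) (F' := F') (x₀ := z₀) (s := Metric.ball z₀ 1)
    (bound := fun Z => ∑ k, (c (m + Pi.single k 1) * Real.exp (r ^ 2 / 2 * ‖Z‖ ^ 2) *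
      Real.exp (∑ k, (‖z₀‖ + 1) * |v k|)) * ‖ℓ k‖)
    (Metric.ball_mem_nhds z₀ one_pos)
    (Eventually.of_forall fun z => by simp only [F]; fun_prop) (hintF m) (hF'meas z₀)
    (ae_of_all _ fun Z z hz => hF'_le z hz Z) hbound
    (ae_of_all _ fun Z z _ => by
      have h1 : HasFDerivAt (fun z : EuclideanSpace ℝ (Fin d) => ∑ k, (z k : ℂ) * W Z k)
          (∑ k, W Z k • ℓ k) z := by
        refine HasFDerivAt.fun_sum fun k _ => ?_
        exact (ℓ k).hasFDerivAt.mul_const (W Z k)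
      have h2 := (h1.cexp).const_mul (∏ j, W Z j ^ m j)
      refine h2.congr_fderiv ?_
      simp only [F', Finset.smul_sum, smul_smul, prod_pow_add_single]
      refine Finset.sum_congr rfl fun k _ => ?_
      congr 1; ring)
  have hF_eq : (fun z => ∫ Z, F z Z ∂(multivariateGaussian 0 A)) = expMoment A v m := rfl
  rw [hF_eq] at hder
  refine ⟨_, hder, fun k => ?_⟩
  have hintF' : Integrable (F' z₀) (multivariateGaussian 0 A) :=
    hbound.mono' (hF'meas z₀) (ae_of_all _ fun Z => hF'_le z₀ hmem Z)
  rw [ContinuousLinearMap.integral_apply hintF', expMoment]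
  refine integral_congr_ae (ae_of_all _ fun Z => ?_)
  simp only [F', _root_.sum_apply, _root_.smul_apply, ℓ]
  rw [Finset.sum_eq_single k]
  · simp [hW]
  · intro b _ hb; simp [hb]
  · simp

theorem dirDeriv_eq_expMoment {A : Matrix (Fin d) (Fin d) ℝ} {v : Fin d → ℝ} {m : Fin d → ℕ}
    {g : EuclideanSpace ℝ (Fin d) → ℝ} (hg : ∀ z, (g z : ℂ) = expMoment A v m z) (k : Fin d)
    (z : EuclideanSpace ℝ (Fin d)) :
    (dirDeriv (EuclideanSpace.single k 1) g z : ℂ) = expMoment A v (m + Pi.single k 1) z := by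
  obtain ⟨F', hF', hk⟩ := hasFDerivAt_expMoment A v m z
  have e : (fun z => (g z : ℂ)) = expMoment A v m := funext hg
  rw [← e] at hF'
  have h1 : HasFDerivAt g (Complex.reCLM.comp F') z := by
    have := Complex.reCLM.hasFDerivAt.comp z hF'
    simpa [Function.comp_def] using this
  have h2 := (Complex.ofRealCLM.hasFDerivAt.comp z h1).unique hF'
  rw [dirDeriv, h1.fderiv, ← hk, ← h2]
  simp

theorem iterate_dirDeriv_eq_expMoment {A : Matrix (Fin d) (Fin d) ℝ} {v : Fin d → ℝ}
    {m : Fin d → ℕ} {g : EuclideanSpace ℝ (Fin d) → ℝ}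
    (hg : ∀ z, (g z : ℂ) = expMoment A v m z) (k : Fin d) (i : ℕ) (z : EuclideanSpace ℝ (Fin d)) :
    (((dirDeriv (EuclideanSpace.single k 1))^[i] g z : ℝ) : ℂ) =
      expMoment A v (m + Pi.single k i) z := by
  induction i generalizing z with
  | zero => simpa using hg z
  | succ i ih =>
    rw [Function.iterate_succ_apply', dirDeriv_eq_expMoment ih, add_assoc, ← Pi.single_add]

theorem mixedDeriv_eq_expMoment {A : Matrix (Fin d) (Fin d) ℝ} {v : Fin d → ℝ}
    {g : EuclideanSpace ℝ (Fin d) → ℝ} (hg : ∀ z, (g z : ℂ) = expMoment A v 0 z) (n : Fin d → ℕ)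
    (z : EuclideanSpace ℝ (Fin d)) :
    (mixedDeriv (fun j => EuclideanSpace.single j 1) n g z : ℂ) = expMoment A v n z := by
  have key : ∀ l : List (Fin d), ∀ z,
      ((l.foldr (fun j h => (dirDeriv (EuclideanSpace.single j 1))^[n j] h) g z : ℝ) : ℂ) =
        expMoment A v ((l.map fun j => (Pi.single j (n j) : Fin d → ℕ)).sum) z := by
    intro l
    induction l with
    | nil => simpa using hg
    | cons a l ih =>
      intro z
      rw [List.foldr_cons, iterate_dirDeriv_eq_expMoment ih, List.map_cons, List.sum_cons, add_comm]
  rw [mixedDeriv, key, ← Fin.sum_univ_def, Finset.univ_sum_single]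

/-- The mixed derivative at the origin of `z ↦ exp (⟨z, v⟩ - ⟨A z, z⟩ / 2)`, a Gaussian average of
`z ↦ exp ⟨z, v + i Z⟩`, is computed under the expectation. -/
theorem mixedDeriv_exp_quadratic {A : Matrix (Fin d) (Fin d) ℝ} (hA : A.PosSemidef)
    (v : Fin d → ℝ) (n : Fin d → ℕ) {g : EuclideanSpace ℝ (Fin d) → ℝ}
    (hg : ∀ z, g z = Real.exp (z.ofLp ⬝ᵥ v - 1 / 2 * (z.ofLp ⬝ᵥ A *ᵥ z.ofLp))) :
    (((Real.sqrt (multiFactorial n))⁻¹ *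
      mixedDeriv (fun j => EuclideanSpace.single j 1) n g 0 : ℝ) : ℂ) = gaussHermite A n v := by
  have h0 : ∀ z, (g z : ℂ) = expMoment A v 0 z := by
    intro z
    have e : ∀ Z : EuclideanSpace ℝ (Fin d),
        (∏ j, ((v j : ℂ) + (Z j : ℂ) * Complex.I) ^ (0 : Fin d → ℕ) j) *
          Complex.exp (∑ k, (z k : ℂ) * ((v k : ℂ) + (Z k : ℂ) * Complex.I)) =
        Complex.exp (∑ k, (z k : ℂ) * (v k : ℂ)) *
          Complex.exp (∑ k, (Complex.I • fun j => (z j : ℂ)) k * (Z k : ℂ)) := by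
      intro Z
      simp only [Pi.zero_apply, pow_zero, Finset.prod_const_one, one_mul]
      rw [← Complex.exp_add, ← Finset.sum_add_distrib]
      congr 1
      refine Finset.sum_congr rfl fun k _ => ?_
      simp only [Pi.smul_apply, smul_eq_mul]; ring
    rw [expMoment]
    simp_rw [e]
    rw [integral_const_mul, integral_cexp_gaussian hA, ← Complex.exp_add, cform_smul_smul,
      Complex.I_sq, cform_ofReal, hg]
    push_cast [dotProduct]
    congr 1; ring
  rw [Complex.ofReal_mul, mixedDeriv_eq_expMoment h0, gaussHermite, expMoment]
  simp [div_eq_inv_mul]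

/-- No smoothness is needed because `L` is invertible, so the chain rule holds also at points where
the Fréchet derivative takes its junk value `0`. -/
theorem mixedDeriv_comp_equiv (L : EuclideanSpace ℝ (Fin d) ≃L[ℝ] EuclideanSpace ℝ (Fin d))
    (a : EuclideanSpace ℝ (Fin d)) (n : Fin d → ℕ) (g : EuclideanSpace ℝ (Fin d) → ℝ)
    (u : Fin d → EuclideanSpace ℝ (Fin d)) (z : EuclideanSpace ℝ (Fin d)) :
    mixedDeriv (fun j => L (u j)) n g (a + L z) = mixedDeriv u n (fun z => g (a + L z)) z := by
  have h1 : ∀ (w : EuclideanSpace ℝ (Fin d)) (f : EuclideanSpace ℝ (Fin d) → ℝ),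
      (fun z => dirDeriv (L w) f (a + L z)) = dirDeriv w fun z => f (a + L z) := by
    intro w f
    funext z
    have := L.comp_right_fderiv (f := fun y => f (a + y)) (x := z)
    simp only [dirDeriv]
    change _ = fderiv ℝ ((fun y => f (a + y)) ∘ L) z w
    rw [this, fderiv_comp_add_left]
    rfl
  have h2 : ∀ (w : EuclideanSpace ℝ (Fin d)) (i : ℕ) (f : EuclideanSpace ℝ (Fin d) → ℝ),
      (fun z => (dirDeriv (L w))^[i] f (a + L z)) = (dirDeriv w)^[i] fun z => f (a + L z) := by
    intro w i
    induction i with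
    | zero => intro f; rfl
    | succ i ih => intro f; rw [Function.iterate_succ_apply, Function.iterate_succ_apply, ← h1, ← ih]
  have h3 : ∀ l : List (Fin d), (fun z => l.foldr (fun j h => (dirDeriv (L (u j)))^[n j] h) g
      (a + L z)) = l.foldr (fun j h => (dirDeriv (u j))^[n j] h) fun z => g (a + L z) := by
    intro l
    induction l with
    | nil => rfl
    | cons b l ih => rw [List.foldr_cons, List.foldr_cons, ← ih, ← h2]
  exact congrFun (h3 _) z

theorem mixedDeriv_const_mul (c : ℝ) (u : Fin d → EuclideanSpace ℝ (Fin d)) (n : Fin d → ℕ)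
    (g : EuclideanSpace ℝ (Fin d) → ℝ) (z : EuclideanSpace ℝ (Fin d)) :
    mixedDeriv u n (fun z => c * g z) z = c * mixedDeriv u n g z := by
  have h1 : ∀ (w : EuclideanSpace ℝ (Fin d)) (f : EuclideanSpace ℝ (Fin d) → ℝ),
      (dirDeriv w fun z => c * f z) = fun z => c * dirDeriv w f z := by
    intro w f
    funext z
    simp only [dirDeriv]
    change fderiv ℝ (c • f) z w = _
    rw [fderiv_const_smul_field]; rfl
  have h2 : ∀ (w : EuclideanSpace ℝ (Fin d)) (i : ℕ) (f : EuclideanSpace ℝ (Fin d) → ℝ),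
      ((dirDeriv w)^[i] fun z => c * f z) = fun z => c * (dirDeriv w)^[i] f z := by
    intro w i
    induction i with
    | zero => intro f; rfl
    | succ i ih => intro f; rw [Function.iterate_succ_apply, h1, ih]; rfl
  have h3 : ∀ l : List (Fin d), (l.foldr (fun j h => (dirDeriv (u j))^[n j] h) fun z => c * g z) =
      fun z => c * l.foldr (fun j h => (dirDeriv (u j))^[n j] h) g z := by
    intro l
    induction l with
    | nil => rfl
    | cons b l ih => rw [List.foldr_cons, ih, h2]; rfl
  exact congrFun (h3 _) z

/-! ### Biorthogonal Hermite families in `L²(N(0, Q))` -/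

/-- The Hermite family of `N(0, Q)` in the linear coordinates `y = T x`, whose covariance is
`T Q Tᵀ`. -/
noncomputable def hermiteFam (Q T : Matrix (Fin d) (Fin d) ℝ) (n : Fin d → ℕ)
    (x : EuclideanSpace ℝ (Fin d)) : ℂ :=
  gaussHermite (T * Q * Tᵀ) n (T *ᵥ x.ofLp)

/-- The generating function of `hermiteFam Q T` at a complex argument. -/
noncomputable def hermiteGen (Q T : Matrix (Fin d) (Fin d) ℝ) (z : Fin d → ℂ)
    (x : EuclideanSpace ℝ (Fin d)) : ℂ :=
  Complex.exp (∑ j, z j * ((T *ᵥ x.ofLp) j : ℂ) - 1 / 2 * cform (T * Q * Tᵀ) z z)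

theorem posSemidef_conj {Q : Matrix (Fin d) (Fin d) ℝ} (hQ : Q.PosSemidef)
    (T : Matrix (Fin d) (Fin d) ℝ) : (T * Q * Tᵀ).PosSemidef := by
  have := hQ.mul_mul_conjTranspose_same T
  rwa [Matrix.conjTranspose_eq_transpose_of_trivial] at this

theorem hasSum_hermiteFam {Q : Matrix (Fin d) (Fin d) ℝ} (hQ : Q.PosSemidef)
    (T : Matrix (Fin d) (Fin d) ℝ) (z : Fin d → ℂ) (x : EuclideanSpace ℝ (Fin d)) :
    HasSum (fun n => hermiteFam Q T n x * ((∏ j, z j ^ n j) / (Real.sqrt (multiFactorial n) : ℂ)))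
      (hermiteGen Q T z x) :=
  hasSum_gaussHermite (posSemidef_conj hQ T) _ _

theorem sum_mulVec_eq (T : Matrix (Fin d) (Fin d) ℝ) (z : Fin d → ℂ)
    (x : Fin d → ℝ) :
    ∑ j, z j * ((T *ᵥ x) j : ℂ) = ∑ k, (z ᵥ* T.map Complex.ofRealHom) k * (x k : ℂ) := by
  have h : ∀ j, ((T *ᵥ x) j : ℂ) = (T.map Complex.ofRealHom *ᵥ fun k => (x k : ℂ)) j := by
    intro j; simp [Matrix.mulVec, dotProduct]
  simp_rw [h]
  exact Matrix.dotProduct_mulVec z _ _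

theorem measurable_hermiteFam (Q T : Matrix (Fin d) (Fin d) ℝ) (n : Fin d → ℕ) :
    StronglyMeasurable (hermiteFam Q T n) := by
  unfold hermiteFam gaussHermite
  simp_rw [div_eq_mul_inv]
  refine StronglyMeasurable.mul_const (StronglyMeasurable.integral_prod_right (f := fun
    (x Z : EuclideanSpace ℝ (Fin d)) => ∏ j, (((T *ᵥ x.ofLp) j : ℂ) + (Z j : ℂ) * Complex.I) ^ n j)
    ?_) _
  refine Continuous.stronglyMeasurable ?_
  simp only [Function.uncurry_def, Matrix.mulVec, dotProduct]
  fun_prop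

theorem continuous_hermiteGen (Q T : Matrix (Fin d) (Fin d) ℝ) (z : Fin d → ℂ) :
    Continuous (hermiteGen Q T z) := by
  unfold hermiteGen
  simp only [Matrix.mulVec, dotProduct]
  fun_prop

theorem exists_sum_mulVec_sq_le (T : Matrix (Fin d) (Fin d) ℝ) :
    ∃ c : ℝ, 0 < c ∧ ∀ x : EuclideanSpace ℝ (Fin d), ∑ j, (T *ᵥ x.ofLp) j ^ 2 ≤ c * ‖x‖ ^ 2 := by
  refine ⟨‖Matrix.toEuclideanCLM (𝕜 := ℝ) T‖ ^ 2 + 1, by positivity, fun x => ?_⟩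
  have h1 := (Matrix.toEuclideanCLM (𝕜 := ℝ) T).le_opNorm x
  have h2 : ∑ j, (T *ᵥ x.ofLp) j ^ 2 = ‖Matrix.toEuclideanCLM (𝕜 := ℝ) T x‖ ^ 2 := by
    rw [EuclideanSpace.real_norm_sq_eq]
    simp
  rw [h2]
  calc _ ≤ (‖Matrix.toEuclideanCLM (𝕜 := ℝ) T‖ * ‖x‖) ^ 2 := by gcongr
    _ ≤ _ := by rw [mul_pow]; gcongr; linarith

theorem exists_norm_hermiteFam_le (Q T : Matrix (Fin d) (Fin d) ℝ) {ε : ℝ} (hε : 0 < ε) :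
    ∃ K R : ℝ, 0 ≤ K ∧ 1 ≤ R ∧ ∀ n x,
      ‖hermiteFam Q T n x‖ ≤ K * R ^ (∑ j, n j) * Real.exp (ε * ‖x‖ ^ 2) := by
  obtain ⟨c, hc, hcx⟩ := exists_sum_mulVec_sq_le T
  obtain ⟨K, R, hK, hR, h⟩ := exists_norm_gaussHermite_le (T * Q * Tᵀ) (ε := ε / c) (by positivity)
  refine ⟨K, R, hK, hR, fun n x => (h n _).trans ?_⟩
  have : ε / c * ∑ j, (T *ᵥ x.ofLp) j ^ 2 ≤ ε * ‖x‖ ^ 2 := by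
    calc _ ≤ ε / c * (c * ‖x‖ ^ 2) := by gcongr; exact hcx x
      _ = _ := by field_simp
  gcongr

theorem exists_norm_hermiteGen_le (Q T : Matrix (Fin d) (Fin d) ℝ) (z : Fin d → ℂ) {ε : ℝ}
    (hε : 0 < ε) :
    ∃ K : ℝ, 0 ≤ K ∧ ∀ x, ‖hermiteGen Q T z x‖ ≤ K * Real.exp (ε * ‖x‖ ^ 2) := by
  set a := z ᵥ* T.map Complex.ofRealHom with ha
  refine ⟨Real.exp (-(1 / 2 * cform (T * Q * Tᵀ) z z).re) *
    Real.exp ((∑ j, ‖a j‖) ^ 2 / (4 * ε)), by positivity, fun x => ?_⟩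
  rw [hermiteGen, Complex.norm_exp, Complex.sub_re, sub_eq_neg_add, Real.exp_add,
    mul_assoc (Real.exp _)]
  refine mul_le_mul_of_nonneg_left (le_trans ?_ (exp_linear_le hε ‖x‖)) (Real.exp_pos _).le
  rw [sum_mulVec_eq]
  refine Real.exp_le_exp.2 ((Complex.re_le_norm _).trans ((norm_sum_le _ _).trans ?_))
  rw [Finset.sum_mul]
  refine Finset.sum_le_sum fun j _ => ?_
  rw [norm_mul, Complex.norm_real]
  exact mul_le_mul_of_nonneg_left (abs_coord_le_norm x j) (norm_nonneg _)

/-- Functions of small square-exponential growth are square integrable for a Gaussian measure. -/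
theorem exists_memLp_exp_sq (Q : Matrix (Fin d) (Fin d) ℝ) :
    ∃ ε : ℝ, 0 < ε ∧ MemLp (fun x : EuclideanSpace ℝ (Fin d) => Real.exp (ε * ‖x‖ ^ 2)) 2
      (multivariateGaussian 0 Q) := by
  obtain ⟨C, hC, hi⟩ := exists_integrable_exp_sq_gaussian 0 Q
  refine ⟨C / 2, by positivity, ?_⟩
  rw [memLp_two_iff_integrable_sq (by fun_prop)]
  refine (hi C le_rfl).congr (ae_of_all _ fun x => ?_)
  simp only
  rw [← Real.exp_nat_mul]; congr 1; push_cast; ring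

theorem memLp_of_exp_sq_bound {μ : Measure (EuclideanSpace ℝ (Fin d))} {ε K : ℝ}
    (hε : MemLp (fun x : EuclideanSpace ℝ (Fin d) => Real.exp (ε * ‖x‖ ^ 2)) 2 μ)
    {f : EuclideanSpace ℝ (Fin d) → ℂ} (hf : AEStronglyMeasurable f μ)
    (h : ∀ x, ‖f x‖ ≤ K * Real.exp (ε * ‖x‖ ^ 2)) : MemLp f 2 μ := by
  refine (hε.const_mul K).mono hf (ae_of_all _ fun x => (h x).trans (le_abs_self _))

theorem memLp_hermiteFam (Q T : Matrix (Fin d) (Fin d) ℝ) (n : Fin d → ℕ) :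
    MemLp (hermiteFam Q T n) 2 (multivariateGaussian 0 Q) := by
  obtain ⟨ε, hε, hm⟩ := exists_memLp_exp_sq Q
  obtain ⟨K, R, -, -, h⟩ := exists_norm_hermiteFam_le Q T hε
  exact memLp_of_exp_sq_bound hm (measurable_hermiteFam Q T n).aestronglyMeasurable (h n)

theorem memLp_hermiteGen (Q T : Matrix (Fin d) (Fin d) ℝ) (z : Fin d → ℂ) :
    MemLp (hermiteGen Q T z) 2 (multivariateGaussian 0 Q) := by
  obtain ⟨ε, hε, hm⟩ := exists_memLp_exp_sq Q
  obtain ⟨K, -, h⟩ := exists_norm_hermiteGen_le Q T z hε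
  exact memLp_of_exp_sq_bound hm (continuous_hermiteGen Q T z).aestronglyMeasurable h

theorem exists_norm_toLp_hermiteFam_le (Q T : Matrix (Fin d) (Fin d) ℝ) :
    ∃ K R : ℝ, 0 ≤ K ∧ 1 ≤ R ∧ ∀ n,
      ‖(memLp_hermiteFam Q T n).toLp _‖ ≤ K * R ^ (∑ j, n j) := by
  obtain ⟨ε, hε, hm⟩ := exists_memLp_exp_sq Q
  obtain ⟨K, R, hK, hR, h⟩ := exists_norm_hermiteFam_le Q T hε
  refine ⟨K * ‖hm.toLp _‖, R, by positivity, hR, fun n => ?_⟩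
  have : ‖(memLp_hermiteFam Q T n).toLp _‖ ≤ (K * R ^ (∑ j, n j)) * ‖hm.toLp _‖ := by
    refine Lp.norm_le_mul_norm_of_ae_le_mul ?_
    filter_upwards [(memLp_hermiteFam Q T n).coeFn_toLp, hm.coeFn_toLp] with x h1 h2
    rw [h1, h2, Real.norm_of_nonneg (Real.exp_pos _).le]
    exact h n x
  linarith

/-- The expansion of the generating function converges in `L²`. -/
theorem hasSum_toLp_hermiteFam {Q : Matrix (Fin d) (Fin d) ℝ} (hQ : Q.PosSemidef)
    (T : Matrix (Fin d) (Fin d) ℝ) (z : Fin d → ℂ) :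
    HasSum (fun n => ((∏ j, z j ^ n j) / (Real.sqrt (multiFactorial n) : ℂ)) •
      (memLp_hermiteFam Q T n).toLp _) ((memLp_hermiteGen Q T z).toLp _) := by
  obtain ⟨ε, hε, hm⟩ := exists_memLp_exp_sq Q
  obtain ⟨K, R, hK, hR, h⟩ := exists_norm_hermiteFam_le Q T hε
  have hsum := (summable_prod_pow_div_sqrt z R (by positivity)).mul_left K
  have := hasSum_toLp_of_dominated
    (fun n => ((∏ j, z j ^ n j) / (Real.sqrt (multiFactorial n) : ℂ)) • hermiteFam Q T n)
    (hermiteGen Q T z) (fun x => Real.exp (ε * ‖x‖ ^ 2)) _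
    (fun n => (memLp_hermiteFam Q T n).const_smul _) (memLp_hermiteGen Q T z) hm
    (fun x => (Real.exp_pos _).le) hsum (fun n x => ?_) (fun x => ?_)
  · exact this
  · rw [Pi.smul_apply, norm_smul]
    calc _ ≤ ‖(∏ j, z j ^ n j) / (Real.sqrt (multiFactorial n) : ℂ)‖ *
          (K * R ^ (∑ j, n j) * Real.exp (ε * ‖x‖ ^ 2)) := by gcongr; exact h n x
      _ = _ := by ring
  · refine (hasSum_hermiteFam hQ T z x).congr_fun fun n => ?_
    simp [mul_comm]

theorem integral_hermiteGen_mul {Q T K : Matrix (Fin d) (Fin d) ℝ} (hQ : Q.PosSemidef)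
    (hTK : T * Q * Kᵀ = 1) (z w : Fin d → ℂ) :
    ∫ x, hermiteGen Q T z x * hermiteGen Q K w x ∂(multivariateGaussian 0 Q) =
      Complex.exp (∑ j, z j * w j) := by
  have hQs : Qᵀ = Q := by
    have := hQ.isHermitian.eq
    rwa [Matrix.conjTranspose_eq_transpose_of_trivial] at this
  have hKT : K * Q * Tᵀ = 1 := by
    have := congrArg Matrix.transpose hTK
    simpa [Matrix.transpose_mul, hQs, Matrix.mul_assoc] using this
  set a := z ᵥ* T.map Complex.ofRealHom with ha
  set b := w ᵥ* K.map Complex.ofRealHom with hb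
  have e : ∀ x, hermiteGen Q T z x * hermiteGen Q K w x =
      Complex.exp (-(1 / 2 * cform (T * Q * Tᵀ) z z) - 1 / 2 * cform (K * Q * Kᵀ) w w) *
        Complex.exp (∑ j, (a + b) j * (x j : ℂ)) := by
    intro x
    rw [hermiteGen, hermiteGen, sum_mulVec_eq, sum_mulVec_eq, ← Complex.exp_add, ← Complex.exp_add]
    simp only [← ha, ← hb, Pi.add_apply, add_mul, Finset.sum_add_distrib]
    congr 1; ring
  simp_rw [e]
  rw [integral_const_mul, integral_cexp_gaussian hQ, ← Complex.exp_add, cform_add_add, ha, hb]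
  simp only [cform_vecMul, hTK, hKT, cform_one]
  rw [dotProduct_comm w z]
  simp only [dotProduct]
  congr 1; ring

/-- Integrating the expansion of the generating function term by term. -/
theorem hasSum_integral_hermiteFam_mul {Q : Matrix (Fin d) (Fin d) ℝ} (hQ : Q.PosSemidef)
    (T : Matrix (Fin d) (Fin d) ℝ) (z : Fin d → ℂ) {g : EuclideanSpace ℝ (Fin d) → ℂ}
    (hg : MemLp g 2 (multivariateGaussian 0 Q)) :
    HasSum (fun n => (∫ x, hermiteFam Q T n x * g x ∂(multivariateGaussian 0 Q)) /
      (Real.sqrt (multiFactorial n) : ℂ) * ∏ j, z j ^ n j)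
      (∫ x, hermiteGen Q T z x * g x ∂(multivariateGaussian 0 Q)) := by
  have h := (hasSum_toLp_hermiteFam hQ T z).mapL (innerSL ℂ (hg.star.toLp _))
  have key : ∀ {f : EuclideanSpace ℝ (Fin d) → ℂ} (hf : MemLp f 2 (multivariateGaussian 0 Q)),
      inner ℂ (hg.star.toLp _) (hf.toLp f) = ∫ x, f x * g x ∂(multivariateGaussian 0 Q) := by
    intro f hf
    rw [L2.inner_def]
    refine integral_congr_ae ?_
    filter_upwards [hg.star.coeFn_toLp, hf.coeFn_toLp] with x h1 h2
    rw [h1, h2, RCLike.inner_apply]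
    simp
  simp only [map_smul, innerSL_apply_apply, key, smul_eq_mul] at h
  refine h.congr_fun fun n => ?_
  ring

theorem integral_hermiteFam_mul_hermiteGen {Q T K : Matrix (Fin d) (Fin d) ℝ}
    (hQ : Q.PosSemidef) (hTK : T * Q * Kᵀ = 1) (n : Fin d → ℕ) (w : Fin d → ℂ) :
    ∫ x, hermiteFam Q T n x * hermiteGen Q K w x ∂(multivariateGaussian 0 Q) =
      (∏ j, w j ^ n j) / (Real.sqrt (multiFactorial n) : ℂ) := by
  have h := congrFun (coeff_unique _ (fun n => (∏ j, w j ^ n j) / ∏ j, ((n j).factorial : ℂ)) _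
    (fun z => hasSum_integral_hermiteFam_mul hQ T z (memLp_hermiteGen Q K w)) fun z => ?_) n
  · rw [div_eq_iff (sqrt_multiFactorial_ne_zero n)] at h
    rw [h, ← sqrt_multiFactorial_mul_self]
    field_simp [sqrt_multiFactorial_ne_zero n]
  · rw [integral_hermiteGen_mul hQ hTK]
    refine (hasSum_exp_pi fun j => z j * w j).congr_fun fun n => ?_
    rw [Finset.prod_div_distrib]
    simp only [mul_pow, Finset.prod_mul_distrib]
    ring

/-- Biorthogonality: both sides of the identity of generating functions
`∫ gen_T(z) gen_K(w) = exp ⟨z, w⟩` are compared coefficientwise, first in `z`, then in `w`. -/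
theorem integral_hermiteFam_mul_hermiteFam {Q T K : Matrix (Fin d) (Fin d) ℝ}
    (hQ : Q.PosSemidef) (hTK : T * Q * Kᵀ = 1) (n m : Fin d → ℕ) :
    ∫ x, hermiteFam Q T n x * hermiteFam Q K m x ∂(multivariateGaussian 0 Q) =
      if m = n then 1 else 0 := by
  have h := congrFun (coeff_unique _
    (fun m => if m = n then 1 / (Real.sqrt (multiFactorial n) : ℂ) else 0) _
    (fun w => hasSum_integral_hermiteFam_mul hQ K w (memLp_hermiteFam Q T n)) fun w => ?_) m
  · rw [div_eq_iff (sqrt_multiFactorial_ne_zero m)] at h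
    simp_rw [mul_comm (hermiteFam Q T n _)]
    rw [h]
    split_ifs with hmn
    · subst hmn
      field_simp [sqrt_multiFactorial_ne_zero m]
    · simp
  · simp_rw [mul_comm (hermiteGen Q K w _)]
    rw [integral_hermiteFam_mul_hermiteGen hQ hTK]
    refine (hasSum_ite_eq n ((∏ j, w j ^ n j) / (Real.sqrt (multiFactorial n) : ℂ))).congr_fun
      fun m => ?_
    split_ifs with hmn
    · subst hmn; ring
    · simp

/-! ### The covariance matrices -/

/-- The integrand `e^{sB} Q e^{sB*}` of the covariance matrices. -/
noncomputable def covIntegrand (Q B : Matrix (Fin d) (Fin d) ℝ) (s : ℝ) :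
    Matrix (Fin d) (Fin d) ℝ :=
  NormedSpace.exp (s • B) * Q * (NormedSpace.exp (s • B))ᵀ

theorem exp_smul_eq {B M : Matrix (Fin d) (Fin d) ℝ} {lam : Fin d → ℝ} (hM : IsUnit M.det)
    (hB : M * B * M⁻¹ = Matrix.diagonal (fun j => -lam j)) (s : ℝ) :
    NormedSpace.exp (s • B) = M⁻¹ * Matrix.diagonal (fun j => Real.exp (-(s * lam j))) * M := by
  have hMu : IsUnit M := (Matrix.isUnit_iff_isUnit_det M).2 hM
  have h1 : s • B = M⁻¹ * Matrix.diagonal (fun j => -(s * lam j)) * M := by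
    have h2 : Matrix.diagonal (fun j => -(s * lam j)) = s • (M * B * M⁻¹) := by
      rw [hB, ← Matrix.diagonal_smul]; congr 1; ext j; simp
    rw [h2]
    simp only [Matrix.mul_smul, Matrix.smul_mul, Matrix.mul_assoc, Matrix.nonsing_inv_mul M hM,
      Matrix.mul_one]
    rw [← Matrix.mul_assoc, Matrix.nonsing_inv_mul M hM, Matrix.one_mul]
  rw [h1, Matrix.exp_conj' _ _ hMu, Matrix.exp_diagonal]
  congr 3
  ext j
  rw [Pi.coe_exp, Real.exp_eq_exp_ℝ]

theorem exp_add_smul (B : Matrix (Fin d) (Fin d) ℝ) (s t : ℝ) :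
    NormedSpace.exp ((s + t) • B) = NormedSpace.exp (t • B) * NormedSpace.exp (s • B) := by
  rw [add_comm, add_smul]
  exact Matrix.exp_add_of_commute _ _ ((Commute.refl B).smul_left _ |>.smul_right _)

theorem covIntegrand_add (Q B : Matrix (Fin d) (Fin d) ℝ) (s t : ℝ) :
    covIntegrand Q B (s + t) =
      NormedSpace.exp (t • B) * covIntegrand Q B s * (NormedSpace.exp (t • B))ᵀ := by
  simp only [covIntegrand, exp_add_smul, Matrix.transpose_mul, Matrix.mul_assoc]

theorem conj_apply (E S : Matrix (Fin d) (Fin d) ℝ) (i j : Fin d) :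
    (E * S * Eᵀ) i j = ∑ l, ∑ k, E i k * S k l * E j l := by
  simp only [Matrix.mul_apply, Matrix.transpose_apply, Finset.sum_mul]

theorem integrableOn_covIntegrand (Q : Matrix (Fin d) (Fin d) ℝ) {B M : Matrix (Fin d) (Fin d) ℝ}
    {lam : Fin d → ℝ} (hM : IsUnit M.det)
    (hB : M * B * M⁻¹ = Matrix.diagonal (fun j => -lam j)) (hlam : ∀ j, 0 < lam j) (a : ℝ)
    (i j : Fin d) : IntegrableOn (fun s => covIntegrand Q B s i j) (Set.Ioi a) := by
  have e : ∀ s, covIntegrand Q B s i j = ∑ l, ∑ k,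
      (M⁻¹ i k * (M * Q * Mᵀ) k l * M⁻¹ j l) * Real.exp (-(lam k + lam l) * s) := by
    intro s
    have h1 : covIntegrand Q B s = M⁻¹ * (Matrix.diagonal (fun j => Real.exp (-(s * lam j))) *
        (M * Q * Mᵀ) * Matrix.diagonal (fun j => Real.exp (-(s * lam j)))) * M⁻¹ᵀ := by
      rw [covIntegrand, exp_smul_eq hM hB]
      simp only [Matrix.transpose_mul, Matrix.diagonal_transpose, Matrix.mul_assoc]
    rw [h1, conj_apply]
    refine Finset.sum_congr rfl fun l _ => Finset.sum_congr rfl fun k _ => ?_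
    rw [Matrix.mul_diagonal, Matrix.diagonal_mul]
    have : Real.exp (-(lam k + lam l) * s) = Real.exp (-(s * lam k)) * Real.exp (-(s * lam l)) := by
      rw [← Real.exp_add]; congr 1; ring
    rw [this]; ring
  simp_rw [e]
  exact integrable_finsetSum _ fun l _ => integrable_finsetSum _ fun k _ =>
    (exp_neg_integrableOn_Ioi a (add_pos (hlam k) (hlam l))).const_mul _

/-- The stationary covariance splits into the covariance accumulated up to time `t` and the
transported stationary covariance. -/
theorem covInf_eq_covT_add (Q : Matrix (Fin d) (Fin d) ℝ) {B M : Matrix (Fin d) (Fin d) ℝ}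
    {lam : Fin d → ℝ} (hM : IsUnit M.det)
    (hB : M * B * M⁻¹ = Matrix.diagonal (fun j => -lam j)) (hlam : ∀ j, 0 < lam j) (t : ℝ) :
    covInf Q B = covT Q B t +
      NormedSpace.exp (t • B) * covInf Q B * (NormedSpace.exp (t • B))ᵀ := by
  have hint := fun a i j => integrableOn_covIntegrand Q hM hB hlam a i j
  ext i j
  rw [Matrix.add_apply, conj_apply]
  change ∫ s in Set.Ioi (0 : ℝ), covIntegrand Q B s i j =
    (∫ s in (0 : ℝ)..t, covIntegrand Q B s i j) + ∑ l, ∑ k, NormedSpace.exp (t • B) i k *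
      (∫ s in Set.Ioi (0 : ℝ), covIntegrand Q B s k l) * NormedSpace.exp (t • B) j l
  rw [← intervalIntegral.integral_interval_add_Ioi (hint 0 i j) (hint t i j)]
  congr 1
  have hpre : (fun s : ℝ => s + t) ⁻¹' Set.Ioi t = Set.Ioi 0 := by
    ext s; simp
  have hshift := (measurePreserving_add_right (volume : Measure ℝ) t).setIntegral_preimage_emb
    (measurableEmbedding_addRight t) (fun s => covIntegrand Q B s i j) (Set.Ioi t)
  rw [hpre] at hshift
  rw [← hshift]
  simp_rw [covIntegrand_add, conj_apply]
  rw [integral_finsetSum _ fun l _ => integrable_finsetSum _ fun k _ =>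
    ((hint 0 k l).const_mul _).mul_const _]
  refine Finset.sum_congr rfl fun l _ => ?_
  rw [integral_finsetSum _ fun k _ => ((hint 0 k l).const_mul _).mul_const _]
  refine Finset.sum_congr rfl fun k _ => ?_
  rw [integral_mul_const, integral_const_mul]

theorem posSemidef_integral {ν : Measure ℝ} {G : ℝ → Matrix (Fin d) (Fin d) ℝ}
    (hG : ∀ s, (G s).PosSemidef) (hint : ∀ i j, Integrable (fun s => G s i j) ν) :
    (Matrix.of fun i j => ∫ s, G s i j ∂ν).PosSemidef := by
  refine Matrix.PosSemidef.of_dotProduct_mulVec_nonneg ?_ fun x => ?_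
  · ext i j
    simp only [Matrix.conjTranspose_apply, Matrix.of_apply, star_trivial]
    congr 1; ext s
    simpa using (hG s).isHermitian.apply i j
  · have e : star x ⬝ᵥ (Matrix.of fun i j => ∫ s, G s i j ∂ν) *ᵥ x =
        ∫ s, star x ⬝ᵥ G s *ᵥ x ∂ν := by
      simp only [dotProduct, Matrix.mulVec, Matrix.of_apply, star_trivial, Finset.mul_sum]
      rw [integral_finsetSum _ fun l _ => integrable_finsetSum _ fun k _ =>
        ((hint l k).mul_const _).const_mul _]
      refine Finset.sum_congr rfl fun l _ => ?_
      rw [integral_finsetSum _ fun k _ => ((hint l k).mul_const _).const_mul _]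
      refine Finset.sum_congr rfl fun k _ => ?_
      rw [integral_const_mul, integral_mul_const]
    rw [e]
    exact integral_nonneg fun s => (hG s).dotProduct_mulVec_nonneg x

theorem posSemidef_covIntegrand {Q : Matrix (Fin d) (Fin d) ℝ} (hQ : Q.PosSemidef)
    (B : Matrix (Fin d) (Fin d) ℝ) (s : ℝ) : (covIntegrand Q B s).PosSemidef :=
  posSemidef_conj hQ _

theorem posSemidef_covT {Q B M : Matrix (Fin d) (Fin d) ℝ} {lam : Fin d → ℝ} (hQ : Q.PosSemidef)
    (hM : IsUnit M.det) (hB : M * B * M⁻¹ = Matrix.diagonal (fun j => -lam j))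
    (hlam : ∀ j, 0 < lam j) {t : ℝ} (ht : 0 ≤ t) : (covT Q B t).PosSemidef := by
  have h := posSemidef_integral (ν := volume.restrict (Set.Ioc 0 t)) (posSemidef_covIntegrand hQ B)
    fun i j => (integrableOn_covIntegrand Q hM hB hlam 0 i j).mono_set Set.Ioc_subset_Ioi_self
  convert h using 1
  ext i j
  simp only [covT, Matrix.of_apply, intervalIntegral.integral_of_le ht]
  rfl

theorem posDef_covInf {Q B M : Matrix (Fin d) (Fin d) ℝ} {lam : Fin d → ℝ} (hQ : Q.PosSemidef)
    (hQt : ∀ t : ℝ, 0 < t → 0 < (covT Q B t).det)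
    (hM : IsUnit M.det) (hB : M * B * M⁻¹ = Matrix.diagonal (fun j => -lam j))
    (hlam : ∀ j, 0 < lam j) : (covInf Q B).PosDef := by
  have h0 : (covInf Q B).PosSemidef := posSemidef_integral (posSemidef_covIntegrand hQ B)
    fun i j => integrableOn_covIntegrand Q hM hB hlam 0 i j
  rw [covInf_eq_covT_add Q hM hB hlam 1]
  refine Matrix.PosDef.add_posSemidef ?_ (posSemidef_conj h0 _)
  rw [(posSemidef_covT hQ hM hB hlam zero_le_one).posDef_iff_isUnit,
    Matrix.isUnit_iff_isUnit_det]
  exact (hQt 1 one_pos).ne'.isUnit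

theorem transpose_eq_of_posDef {S : Matrix (Fin d) (Fin d) ℝ} (hS : S.PosDef) : Sᵀ = S := by
  have := hS.isHermitian.eq
  rwa [Matrix.conjTranspose_eq_transpose_of_trivial] at this

/-! ### The coordinates `y = T x` -/

theorem smallestEigenvalue_pos [NeZero d] {S : Matrix (Fin d) (Fin d) ℝ} (hS : S.PosDef) :
    0 < smallestEigenvalue S := by
  have hne : {r : ℝ | Module.End.HasEigenvalue (Matrix.toLin' S) r}.Nonempty := by
    have i : Fin d := 0
    refine ⟨hS.isHermitian.eigenvalues i, Module.End.hasEigenvalue_of_hasEigenvector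
      (x := (hS.isHermitian.eigenvectorBasis i).ofLp) ⟨?_, ?_⟩⟩
    · rw [Module.End.mem_eigenspace_iff, Matrix.toLin'_apply]
      exact hS.isHermitian.mulVec_eigenvectorBasis i
    · intro h
      exact hS.isHermitian.eigenvectorBasis.toBasis.ne_zero i (by
        rw [OrthonormalBasis.coe_toBasis]; ext j; exact congrFun h j)
  have hmem : smallestEigenvalue S ∈ {r : ℝ | Module.End.HasEigenvalue (Matrix.toLin' S) r} :=
    hne.csInf_mem (Module.End.finite_hasEigenvalue _)
  obtain ⟨v, hv, hv0⟩ := hmem.exists_hasEigenvector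
  rw [Module.End.mem_eigenspace_iff, Matrix.toLin'_apply] at hv
  have h1 := hS.dotProduct_mulVec_pos hv0
  rw [hv, dotProduct_smul, smul_eq_mul, star_trivial] at h1
  have h2 : 0 ≤ v ⬝ᵥ v := Finset.sum_nonneg fun i _ => mul_self_nonneg _
  exact pos_of_mul_pos_left h1 h2

/-- The constant `ϱ` enters only through its positivity, which makes `T` invertible. -/
theorem isUnit_det_coord [NeZero d] {Q B M : Matrix (Fin d) (Fin d) ℝ} {lam : Fin d → ℝ}
    (hS : (covInf Q B).PosDef) (hM : IsUnit M.det) (hlam : ∀ j, 0 < lam j) :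
    IsUnit (coord Q B M lam).det := by
  have hMu : IsUnit M := (Matrix.isUnit_iff_isUnit_det M).2 hM
  have hrho : 0 < rho Q B M lam := by
    refine smallestEigenvalue_pos (Matrix.PosDef.smul ?_ (hlam 0))
    have h1 : (M * covInf Q B * Mᵀ).PosSemidef := posSemidef_conj hS.posSemidef M
    rw [h1.posDef_iff_isUnit, Matrix.isUnit_iff_isUnit_det, Matrix.det_mul, Matrix.det_mul,
      Matrix.det_transpose]
    exact (hM.mul hS.det_pos.ne'.isUnit).mul hM
  rw [coord, Matrix.det_mul, Matrix.det_diagonal]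
  refine IsUnit.mul (Finset.prod_pos fun j _ => ?_).ne'.isUnit hM
  exact Real.sqrt_pos.2 (div_pos (hlam j) hrho)

theorem coord_mul_exp [NeZero d] (Q : Matrix (Fin d) (Fin d) ℝ) {B M : Matrix (Fin d) (Fin d) ℝ}
    {lam : Fin d → ℝ} (hM : IsUnit M.det)
    (hB : M * B * M⁻¹ = Matrix.diagonal (fun j => -lam j)) (t : ℝ) :
    coord Q B M lam * NormedSpace.exp (t • B) =
      Matrix.diagonal (fun j => Real.exp (-(t * lam j))) * coord Q B M lam := by
  rw [exp_smul_eq hM hB, coord]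
  simp only [Matrix.mul_assoc]
  rw [← Matrix.mul_assoc M, Matrix.mul_nonsing_inv M hM, Matrix.one_mul, ← Matrix.mul_assoc,
    ← Matrix.mul_assoc, Matrix.diagonal_mul_diagonal, Matrix.diagonal_mul_diagonal]
  simp only [mul_comm]

theorem tendsto_exp_smul {B M : Matrix (Fin d) (Fin d) ℝ} {lam : Fin d → ℝ} (hM : IsUnit M.det)
    (hB : M * B * M⁻¹ = Matrix.diagonal (fun j => -lam j)) (hlam : ∀ j, 0 < lam j) :
    Tendsto (fun t : ℝ => NormedSpace.exp (t • B)) atTop (𝓝 0) := by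
  have h1 : Tendsto (fun t : ℝ => Matrix.diagonal (fun j => Real.exp (-(t * lam j)))) atTop
      (𝓝 (0 : Matrix (Fin d) (Fin d) ℝ)) := by
    rw [← Matrix.diagonal_zero]
    refine ((continuous_id.matrix_diagonal).tendsto _).comp (tendsto_pi_nhds.2 fun j => ?_)
    exact Real.tendsto_exp_neg_atTop_nhds_zero.comp (tendsto_id.atTop_mul_const (hlam j))
  simp_rw [exp_smul_eq hM hB]
  have h2 := (tendsto_const_nhds (x := M⁻¹)).mul h1 |>.mul (tendsto_const_nhds (x := M))
  simpa using h2

theorem inner_toEuclideanLin_left (T : Matrix (Fin d) (Fin d) ℝ)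
    (x y : EuclideanSpace ℝ (Fin d)) :
    inner ℝ (Matrix.toEuclideanLin T x) y = y.ofLp ⬝ᵥ T *ᵥ x.ofLp := by
  simp [EuclideanSpace.inner_eq_star_dotProduct]

theorem inner_toEuclideanLin_right (T : Matrix (Fin d) (Fin d) ℝ)
    (x y : EuclideanSpace ℝ (Fin d)) :
    inner ℝ y (Matrix.toEuclideanLin T x) = inner ℝ (Matrix.toEuclideanLin Tᵀ y) x := by
  rw [inner_toEuclideanLin_left, real_inner_comm, inner_toEuclideanLin_left,
    Matrix.dotProduct_mulVec, Matrix.mulVec_transpose, dotProduct_comm]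

/-! ### The density of a nondegenerate Gaussian measure -/

theorem continuous_density (Q B : Matrix (Fin d) (Fin d) ℝ) : Continuous (density Q B) := by
  unfold density
  simp only [inner_toEuclideanLin_left, Matrix.mulVec, dotProduct]
  fun_prop

theorem integral_density_mul_character {Q B : Matrix (Fin d) (Fin d) ℝ}
    (hS : (covInf Q B).PosDef) (ξ : EuclideanSpace ℝ (Fin d)) :
    ∫ x, (density Q B x : ℂ) * Complex.exp (inner ℝ x ξ * Complex.I) =
      Complex.exp (-(((ξ.ofLp ⬝ᵥ covInf Q B *ᵥ ξ.ofLp : ℝ) : ℂ) / 2)) := by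
  obtain ⟨R, hR, hRs, -⟩ := exists_sq_of_posSemidef hS.posSemidef
  have hdet : R.det * R.det = (covInf Q B).det := by
    conv_lhs => rw [← Matrix.det_transpose R]
    rw [← hR, Matrix.det_mul, hRs]
  have hR0 : R.det ≠ 0 := fun h => hS.det_pos.ne' (by rw [← hdet, h, zero_mul])
  have hRu : IsUnit R.det := hR0.isUnit
  -- Substituting `x = R w` with `R Rᵀ = Q_∞` makes the quadratic form isotropic.
  have hmap := Measure.map_linearMap_addHaar_eq_smul_addHaar
    (volume : Measure (EuclideanSpace ℝ (Fin d))) (f := Matrix.toEuclideanLin R)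
    (by rwa [LinearMap.det_toLpLin])
  rw [LinearMap.det_toLpLin] at hmap
  have hcont : Continuous (Matrix.toEuclideanLin R) := LinearMap.continuous_of_finiteDimensional _
  set g : EuclideanSpace ℝ (Fin d) → ℂ := fun x =>
    (density Q B x : ℂ) * Complex.exp (inner ℝ x ξ * Complex.I) with hg
  have hgc : Continuous g := by
    have := continuous_density Q B
    fun_prop
  have h1 : ∫ w, g (Matrix.toEuclideanLin R w) = |R.det|⁻¹ * ∫ x, g x := by
    rw [← integral_map hcont.aemeasurable hgc.aestronglyMeasurable, hmap, integral_smul_measure,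
      ENNReal.toReal_ofReal (abs_nonneg _), abs_inv, Complex.real_smul]
  have h2 : ∀ w, g (Matrix.toEuclideanLin R w) =
      ((Real.sqrt ((2 * Real.pi) ^ d * (covInf Q B).det))⁻¹ : ℝ) *
        Complex.exp (-(1 / 2 : ℂ) * (‖w‖ : ℂ) ^ 2 +
          Complex.I * (inner ℝ (Matrix.toEuclideanLin Rᵀ ξ) w : ℝ)) := by
    intro w
    have e1 : inner ℝ (Matrix.toEuclideanLin (covInf Q B)⁻¹ (Matrix.toEuclideanLin R w))
        (Matrix.toEuclideanLin R w) = ‖w‖ ^ 2 := by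
      rw [inner_toEuclideanLin_right, ← real_inner_self_eq_norm_sq]
      congr 1
      ext j
      simp only [Matrix.ofLp_toLpLin, Matrix.toLin'_apply, Matrix.mulVec_mulVec]
      rw [← hR, Matrix.mul_inv_rev, Matrix.mul_assoc, Matrix.nonsing_inv_mul _ hRu, Matrix.mul_one,
        Matrix.mul_nonsing_inv _ (by rwa [Matrix.det_transpose]), Matrix.one_mulVec]
    have e2 : inner ℝ (Matrix.toEuclideanLin R w) ξ =
        inner ℝ (Matrix.toEuclideanLin Rᵀ ξ) w := by
      rw [real_inner_comm, inner_toEuclideanLin_right]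
    simp only [hg]
    rw [density, e1, e2, Complex.ofReal_mul, mul_assoc, Complex.ofReal_exp, ← Complex.exp_add]
    congr 2
    push_cast; ring
  simp_rw [h2] at h1
  rw [integral_const_mul, GaussianFourier.integral_cexp_neg_mul_sq_norm_add (by norm_num)] at h1
  have h3 : ∫ x, g x = |R.det| * (((Real.sqrt ((2 * Real.pi) ^ d * (covInf Q B).det))⁻¹ : ℝ) *
      ((Real.pi / (1 / 2 : ℂ)) ^ (Module.finrank ℝ (EuclideanSpace ℝ (Fin d)) / 2 : ℂ) *
      Complex.exp (Complex.I ^ 2 * ‖Matrix.toEuclideanLin Rᵀ ξ‖ ^ 2 / (4 * (1 / 2))))) := by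
    rw [h1, ← mul_assoc, ← Complex.ofReal_mul, mul_inv_cancel₀ (by simpa using hR0),
      Complex.ofReal_one, one_mul]
  rw [h3]
  have h4 : (Real.pi / (1 / 2 : ℂ)) ^ (Module.finrank ℝ (EuclideanSpace ℝ (Fin d)) / 2 : ℂ) =
      (Real.sqrt ((2 * Real.pi) ^ d) : ℂ) := by
    have : (Real.pi / (1 / 2 : ℂ)) = ((2 * Real.pi : ℝ) : ℂ) := by push_cast; ring
    rw [this, finrank_euclideanSpace_fin, Real.sqrt_eq_rpow, ← Real.rpow_natCast,
      ← Real.rpow_mul (by positivity), Complex.ofReal_cpow (by positivity)]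
    push_cast; congr 1; ring
  have h5 : |R.det| = Real.sqrt (covInf Q B).det := by
    rw [← hdet, Real.sqrt_mul_self_eq_abs]
  have h6 : ‖Matrix.toEuclideanLin Rᵀ ξ‖ ^ 2 = ξ.ofLp ⬝ᵥ covInf Q B *ᵥ ξ.ofLp := by
    rw [← real_inner_self_eq_norm_sq, inner_toEuclideanLin_right, Matrix.transpose_transpose,
      ← hR, ← inner_toEuclideanLin_left]
    congr 1
    ext j
    simp [Matrix.mulVec_mulVec]
  rw [h4, h5, Real.sqrt_mul (by positivity)]
  have h7 : (Real.sqrt (covInf Q B).det : ℂ) ≠ 0 := by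
    rw [Complex.ofReal_ne_zero]; exact (Real.sqrt_pos.2 hS.det_pos).ne'
  have h8 : (Real.sqrt ((2 * Real.pi) ^ d) : ℂ) ≠ 0 := by
    rw [Complex.ofReal_ne_zero]; exact (Real.sqrt_pos.2 (by positivity)).ne'
  rw [← Complex.ofReal_pow, h6]
  push_cast
  rw [Complex.I_sq]
  field_simp
  congr 1; ring

theorem density_pos {Q B : Matrix (Fin d) (Fin d) ℝ} (hS : (covInf Q B).PosDef)
    (x : EuclideanSpace ℝ (Fin d)) : 0 < density Q B x := by
  have := hS.det_pos
  unfold density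
  positivity

theorem invMeasure_eq {Q B : Matrix (Fin d) (Fin d) ℝ} (hS : (covInf Q B).PosDef) :
    invMeasure Q B = multivariateGaussian 0 (covInf Q B) := by
  -- The integral of the density is `1`, hence not the junk value of a nonintegrable function.
  have hint : Integrable (fun x => (density Q B x : ℂ)) := by
    by_contra h
    have h1 := integral_density_mul_character hS 0
    simp only [inner_zero_right, Complex.ofReal_zero, zero_mul, Complex.exp_zero, mul_one] at h1
    rw [integral_undef h] at h1
    simp at h1
  have hre : Integrable (density Q B) := by simpa using hint.re
  have : IsFiniteMeasure (invMeasure Q B) := isFiniteMeasure_withDensity hre.lintegral_lt_top.ne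
  refine Measure.ext_of_charFun (funext fun ξ => ?_)
  rw [charFun_multivariateGaussian hS.posSemidef, charFun_apply, invMeasure,
    integral_withDensity_eq_integral_toReal_smul
      (continuous_density Q B).measurable.ennreal_ofReal
      (ae_of_all _ fun x => ENNReal.ofReal_lt_top)]
  have e : ∀ x : EuclideanSpace ℝ (Fin d), (ENNReal.ofReal (density Q B x)).toReal •
      Complex.exp (inner ℝ x ξ * Complex.I) =
      (density Q B x : ℂ) * Complex.exp (inner ℝ x ξ * Complex.I) := fun x => by
    rw [ENNReal.toReal_ofReal (density_pos hS x).le, Complex.real_smul]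
  simp_rw [e]
  rw [integral_density_mul_character hS]
  congr 1; simp

/-! ### The transition kernels and the invariant distribution -/

/-- The transition kernel at time `t`, as a Markov kernel. -/
noncomputable def transKernel (Q B : Matrix (Fin d) (Fin d) ℝ) (t : ℝ) :
    Kernel (EuclideanSpace ℝ (Fin d)) (EuclideanSpace ℝ (Fin d)) where
  toFun := kernel Q B t
  measurable' := by
    refine Measure.measurable_of_measurable_coe _ fun s hs => ?_
    have hE : Continuous (Matrix.toEuclideanLin (NormedSpace.exp (t • B))) :=
      LinearMap.continuous_of_finiteDimensional _
    open scoped MatrixOrder in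
    have e : ∀ x, kernel Q B t x s = stdGaussian (EuclideanSpace ℝ (Fin d)) (Prod.mk x ⁻¹'
        {p : EuclideanSpace ℝ (Fin d) × EuclideanSpace ℝ (Fin d) |
          Matrix.toEuclideanLin (NormedSpace.exp (t • B)) p.1 +
            Matrix.toEuclideanCLM (𝕜 := ℝ) (CFC.sqrt (covT Q B t)) p.2 ∈ s}) := by
      intro x
      rw [kernel, multivariateGaussian, Measure.map_apply (by fun_prop) hs]
      rfl
    simp_rw [e]
    refine measurable_measure_prodMk_left (measurableSet_preimage ?_ hs)
    exact (((hE.comp continuous_fst).add (by fun_prop))).measurable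

instance (Q B : Matrix (Fin d) (Fin d) ℝ) (t : ℝ) : IsMarkovKernel (transKernel Q B t) :=
  ⟨fun x => by
    change IsProbabilityMeasure (multivariateGaussian _ _)
    infer_instance⟩

theorem charFun_kernel {Q B : Matrix (Fin d) (Fin d) ℝ} {t : ℝ} (h : (covT Q B t).PosSemidef)
    (x ξ : EuclideanSpace ℝ (Fin d)) :
    charFun (kernel Q B t x) ξ =
      Complex.exp (inner ℝ x (Matrix.toEuclideanLin (NormedSpace.exp (t • B))ᵀ ξ) * Complex.I) *
        Complex.exp (-(((ξ.ofLp ⬝ᵥ covT Q B t *ᵥ ξ.ofLp : ℝ) : ℂ) / 2)) := by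
  rw [kernel, charFun_multivariateGaussian h, ← Complex.exp_add, inner_toEuclideanLin_right,
    real_inner_comm x]
  simp [sub_eq_add_neg]

theorem charFun_bind_transKernel {Q B : Matrix (Fin d) (Fin d) ℝ} {t : ℝ}
    (h : (covT Q B t).PosSemidef) (ν : Measure (EuclideanSpace ℝ (Fin d)))
    [IsProbabilityMeasure ν] (ξ : EuclideanSpace ℝ (Fin d)) :
    charFun (ν.bind (transKernel Q B t)) ξ =
      charFun ν (Matrix.toEuclideanLin (NormedSpace.exp (t • B))ᵀ ξ) *
        Complex.exp (-(((ξ.ofLp ⬝ᵥ covT Q B t *ᵥ ξ.ofLp : ℝ) : ℂ) / 2)) := by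
  have hi : Integrable (fun y : EuclideanSpace ℝ (Fin d) =>
      Complex.exp (inner ℝ y ξ * Complex.I)) (ν.bind (transKernel Q B t)) :=
    (memLp_character ξ).integrable (by norm_num)
  rw [charFun_apply, charFun_apply]
  rw [Measure.comp_eq_comp_const_apply] at hi ⊢
  rw [Kernel.integral_comp hi, Kernel.const_apply, ← integral_mul_const]
  exact integral_congr_ae (ae_of_all _ fun x => charFun_kernel h x ξ)

theorem isInvariantDistribution_iff {Q B : Matrix (Fin d) (Fin d) ℝ}
    {ν : Measure (EuclideanSpace ℝ (Fin d))} [IsProbabilityMeasure ν] :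
    IsInvariantDistribution Q B ν ↔ ∀ t : ℝ, 0 < t → ν.bind (transKernel Q B t) = ν := by
  refine ⟨fun h t ht => Measure.ext fun s hs => ?_, fun h => ⟨inferInstance, fun t ht s hs => ?_⟩⟩
  · rw [Measure.bind_apply hs (transKernel Q B t).measurable.aemeasurable]
    exact h.2 t ht s hs
  · conv_rhs => rw [← h t ht, Measure.bind_apply hs (transKernel Q B t).measurable.aemeasurable]
    rfl

theorem dotProduct_covInf_eq {Q : Matrix (Fin d) (Fin d) ℝ} {B M : Matrix (Fin d) (Fin d) ℝ}
    {lam : Fin d → ℝ} (hM : IsUnit M.det)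
    (hB : M * B * M⁻¹ = Matrix.diagonal (fun j => -lam j)) (hlam : ∀ j, 0 < lam j) (t : ℝ)
    (ξ : EuclideanSpace ℝ (Fin d)) :
    ξ.ofLp ⬝ᵥ covInf Q B *ᵥ ξ.ofLp = ξ.ofLp ⬝ᵥ covT Q B t *ᵥ ξ.ofLp +
      (Matrix.toEuclideanLin (NormedSpace.exp (t • B))ᵀ ξ).ofLp ⬝ᵥ
        covInf Q B *ᵥ (Matrix.toEuclideanLin (NormedSpace.exp (t • B))ᵀ ξ).ofLp := by
  conv_lhs => rw [covInf_eq_covT_add Q hM hB hlam t]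
  rw [Matrix.add_mulVec, dotProduct_add]
  congr 1
  simp only [Matrix.ofLp_toLpLin, Matrix.toLin'_apply, ← Matrix.mulVec_mulVec]
  rw [Matrix.dotProduct_mulVec, ← Matrix.mulVec_transpose]

theorem bind_transKernel_eq {Q B M : Matrix (Fin d) (Fin d) ℝ} {lam : Fin d → ℝ}
    (hQ : Q.PosSemidef) (hS : (covInf Q B).PosDef) (hM : IsUnit M.det)
    (hB : M * B * M⁻¹ = Matrix.diagonal (fun j => -lam j))
    (hlam : ∀ j, 0 < lam j) {t : ℝ} (ht : 0 ≤ t) :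
    (multivariateGaussian 0 (covInf Q B)).bind (transKernel Q B t) =
      multivariateGaussian 0 (covInf Q B) := by
  refine Measure.ext_of_charFun (funext fun ξ => ?_)
  rw [charFun_bind_transKernel (posSemidef_covT hQ hM hB hlam ht),
    charFun_multivariateGaussian hS.posSemidef, charFun_multivariateGaussian hS.posSemidef,
    ← Complex.exp_add, dotProduct_covInf_eq hM hB hlam t ξ]
  congr 1
  simp only [inner_zero_right]
  push_cast; ring

/-- Letting `t → ∞` in the invariance relation determines the characteristic function of an
invariant distribution, since `e^{tB*} ξ → 0`. -/
theorem eq_gaussian_of_invariant {Q B M : Matrix (Fin d) (Fin d) ℝ} {lam : Fin d → ℝ}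
    (hQ : Q.PosSemidef) (hS : (covInf Q B).PosDef) (hM : IsUnit M.det)
    (hB : M * B * M⁻¹ = Matrix.diagonal (fun j => -lam j))
    (hlam : ∀ j, 0 < lam j) (ν : Measure (EuclideanSpace ℝ (Fin d))) [IsProbabilityMeasure ν]
    (hν : ∀ t : ℝ, 0 < t → ν.bind (transKernel Q B t) = ν) :
    ν = multivariateGaussian 0 (covInf Q B) := by
  refine Measure.ext_of_charFun (funext fun ξ => ?_)
  set η : ℝ → EuclideanSpace ℝ (Fin d) := fun t =>
    Matrix.toEuclideanLin (NormedSpace.exp (t • B))ᵀ ξ with hη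
  have hη0 : Tendsto η atTop (𝓝 0) := by
    have h1 := tendsto_exp_smul hM hB hlam
    have h2 : Continuous fun E : Matrix (Fin d) (Fin d) ℝ => Matrix.toEuclideanLin Eᵀ ξ := by
      refine (PiLp.continuous_toLp 2 _).comp (?_ : Continuous fun E : Matrix (Fin d) (Fin d) ℝ =>
        Eᵀ *ᵥ ξ.ofLp)
      fun_prop
    have h3 := (h2.tendsto 0).comp h1
    rw [Matrix.transpose_zero, map_zero, LinearMap.zero_apply] at h3
    exact h3
  have hrel : ∀ t : ℝ, 0 < t → charFun ν ξ = charFun ν (η t) *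
      Complex.exp (-(((ξ.ofLp ⬝ᵥ covInf Q B *ᵥ ξ.ofLp -
        (η t).ofLp ⬝ᵥ covInf Q B *ᵥ (η t).ofLp : ℝ) : ℂ) / 2)) := by
    intro t ht
    conv_lhs => rw [← hν t ht]
    rw [charFun_bind_transKernel (posSemidef_covT hQ hM hB hlam ht.le),
      dotProduct_covInf_eq hM hB hlam t ξ, add_sub_cancel_right]
  have hquad : Continuous fun y : EuclideanSpace ℝ (Fin d) => charFun ν y *
      Complex.exp (-(((ξ.ofLp ⬝ᵥ covInf Q B *ᵥ ξ.ofLp -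
        y.ofLp ⬝ᵥ covInf Q B *ᵥ y.ofLp : ℝ) : ℂ) / 2)) := by
    refine continuous_charFun.mul ?_
    simp only [Matrix.mulVec, dotProduct]
    fun_prop
  have hlim := (hquad.tendsto 0).comp hη0
  have hconst : Tendsto (fun _ : ℝ => charFun ν ξ) atTop (𝓝 (charFun ν ξ)) := tendsto_const_nhds
  have := tendsto_nhds_unique hconst (hlim.congr' ((eventually_gt_atTop 0).mono fun t ht =>
    (hrel t ht).symm))
  rw [this, charFun_multivariateGaussian hS.posSemidef]
  simp

/-! ### Eigenfunctions and co-eigenfunctions as Hermite families -/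

theorem eigenfun_eq_hermiteFam [NeZero d] {Q B : Matrix (Fin d) (Fin d) ℝ}
    (M : Matrix (Fin d) (Fin d) ℝ) (lam : Fin d → ℝ) (hS : (covInf Q B).PosDef) (n : Fin d → ℕ)
    (x : EuclideanSpace ℝ (Fin d)) :
    (eigenfun Q B M lam n x : ℂ) = hermiteFam (covInf Q B) (coord Q B M lam) n x := by
  refine mixedDeriv_exp_quadratic (posSemidef_conj hS.posSemidef _) _ n fun z => ?_
  rw [genFun, inner_toEuclideanLin_left, inner_toEuclideanLin_right, Matrix.transpose_transpose,
    inner_toEuclideanLin_left]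
  congr 3
  simp only [Matrix.ofLp_toLpLin, Matrix.toLin'_apply, Matrix.mulVec_mulVec, Matrix.mul_assoc]

theorem gaussHermite_neg {A : Matrix (Fin d) (Fin d) ℝ} (hA : A.PosSemidef) (n : Fin d → ℕ)
    (v : Fin d → ℝ) : gaussHermite A n (-v) = (-1) ^ (∑ j, n j) * gaussHermite A n v := by
  have h := congrFun (coeff_unique
    (fun n => gaussHermite A n (-v) / (Real.sqrt (multiFactorial n) : ℂ))
    (fun n => (-1) ^ (∑ j, n j) * gaussHermite A n v / (Real.sqrt (multiFactorial n) : ℂ)) _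
    (fun z => (hasSum_gaussHermite hA (-v) z).congr_fun fun n => by ring) fun z => ?_) n
  · exact (div_left_inj' (sqrt_multiFactorial_ne_zero n)).1 h
  · have h1 := hasSum_gaussHermite hA v (-z)
    have e1 : ∑ j, (-z) j * (v j : ℂ) - 1 / 2 * cform A (-z) (-z) =
        ∑ j, z j * ((-v) j : ℝ) - 1 / 2 * cform A z z := by
      have := cform_smul_smul A (-1) z z
      simp only [neg_one_smul] at this
      rw [this]; simp
    rw [e1] at h1
    refine h1.congr_fun fun n => ?_
    simp_rw [Pi.neg_apply, neg_pow (z _), Finset.prod_mul_distrib, Finset.prod_pow_eq_pow_sum]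
    ring

/-- The matrix `(T⁻¹)* Q_∞⁻¹` of the coordinates in which the co-eigenfunctions are Hermite
polynomials. -/
noncomputable def dualCoord (S T : Matrix (Fin d) (Fin d) ℝ) : Matrix (Fin d) (Fin d) ℝ :=
  T⁻¹ᵀ * S⁻¹

theorem coord_mul_dualCoord {S T : Matrix (Fin d) (Fin d) ℝ} (hS : S.PosDef)
    (hT : IsUnit T.det) : T * S * (dualCoord S T)ᵀ = 1 := by
  rw [dualCoord, Matrix.transpose_mul, Matrix.transpose_transpose, Matrix.transpose_nonsing_inv,
    transpose_eq_of_posDef hS, Matrix.mul_assoc,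
    Matrix.mul_nonsing_inv_cancel_left _ _ hS.det_pos.ne'.isUnit, Matrix.mul_nonsing_inv _ hT]

theorem dualCoord_conj {S T : Matrix (Fin d) (Fin d) ℝ} (hS : S.PosDef) :
    dualCoord S T * S * (dualCoord S T)ᵀ = T⁻¹ᵀ * S⁻¹ * T⁻¹ := by
  rw [dualCoord, Matrix.transpose_mul, Matrix.transpose_transpose, Matrix.transpose_nonsing_inv S,
    transpose_eq_of_posDef hS, Matrix.mul_assoc (T⁻¹ᵀ * S⁻¹),
    Matrix.mul_nonsing_inv_cancel_left _ _ hS.det_pos.ne'.isUnit]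

/-- Translating the density along `T⁻¹ z` produces the generating function of the Hermite family
with matrix `dualCoord`, so the mixed derivatives along `T⁻¹ eⱼ` are Hermite polynomials. -/
theorem coeigenfun_eq_hermiteFam [NeZero d] {Q B M : Matrix (Fin d) (Fin d) ℝ} {lam : Fin d → ℝ}
    (hS : (covInf Q B).PosDef) (hT : IsUnit (coord Q B M lam).det) (n : Fin d → ℕ)
    (x : EuclideanSpace ℝ (Fin d)) :
    (coeigenfun Q B M lam n x : ℂ) =
      hermiteFam (covInf Q B) (dualCoord (covInf Q B) (coord Q B M lam)) n x := by
  set S := covInf Q B with hSdef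
  set T := coord Q B M lam with hTdef
  have hSs : S⁻¹ᵀ = S⁻¹ := by rw [Matrix.transpose_nonsing_inv, transpose_eq_of_posDef hS]
  set K := dualCoord S T with hK
  have hA : (K * S * Kᵀ).PosSemidef := posSemidef_conj hS.posSemidef K
  have hUdet : IsUnit (T⁻¹).det := Matrix.isUnit_nonsing_inv_det T hT
  let L : EuclideanSpace ℝ (Fin d) ≃L[ℝ] EuclideanSpace ℝ (Fin d) :=
    (LinearMap.equivOfDetNeZero (Matrix.toEuclideanLin T⁻¹) (by
      rw [LinearMap.det_toLpLin]; exact hUdet.ne_zero)).toContinuousLinearEquiv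
  have hL : ∀ z, L z = Matrix.toEuclideanLin T⁻¹ z := fun z => rfl
  have hx := density_pos hS x
  have htrans : ∀ z, density Q B (x + L z) = density Q B x *
      Real.exp (z.ofLp ⬝ᵥ (-(K *ᵥ x.ofLp)) - 1 / 2 * (z.ofLp ⬝ᵥ (K * S * Kᵀ) *ᵥ z.ofLp)) := by
    intro z
    have e1 : inner ℝ (Matrix.toEuclideanLin S⁻¹ x) (L z) = z.ofLp ⬝ᵥ K *ᵥ x.ofLp := by
      rw [hL, inner_toEuclideanLin_right, inner_toEuclideanLin_left]
      simp only [Matrix.ofLp_toLpLin, Matrix.toLin'_apply, Matrix.mulVec_mulVec, hK, dualCoord]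
    have e2 : inner ℝ (Matrix.toEuclideanLin S⁻¹ (L z)) x = z.ofLp ⬝ᵥ K *ᵥ x.ofLp := by
      rw [← e1, real_inner_comm, inner_toEuclideanLin_right, hSs]
    have e3 : inner ℝ (Matrix.toEuclideanLin S⁻¹ (L z)) (L z) =
        z.ofLp ⬝ᵥ (K * S * Kᵀ) *ᵥ z.ofLp := by
      rw [hK, dualCoord_conj hS, hL, inner_toEuclideanLin_right, inner_toEuclideanLin_left]
      simp only [Matrix.ofLp_toLpLin, Matrix.toLin'_apply, Matrix.mulVec_mulVec, Matrix.mul_assoc]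
    rw [density, density, ← hSdef, mul_assoc, ← Real.exp_add, map_add, inner_add_left,
      inner_add_right, inner_add_right, e1, e2, e3, dotProduct_neg]
    congr 2; ring
  have hder : mixedDeriv (fun j => Matrix.toEuclideanLin T⁻¹ (EuclideanSpace.single j 1)) n
      (density Q B) x = density Q B x * mixedDeriv (fun j => EuclideanSpace.single j 1) n
        (fun z => Real.exp (z.ofLp ⬝ᵥ (-(K *ᵥ x.ofLp)) -
          1 / 2 * (z.ofLp ⬝ᵥ (K * S * Kᵀ) *ᵥ z.ofLp))) 0 := by
    have h1 := mixedDeriv_comp_equiv L x n (density Q B) (fun j => EuclideanSpace.single j 1) 0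
    rw [map_zero, add_zero] at h1
    rw [← mixedDeriv_const_mul]
    simp_rw [← htrans]
    exact h1
  have h2 := mixedDeriv_exp_quadratic hA (-(K *ᵥ x.ofLp)) n fun z => rfl
  rw [gaussHermite_neg hA] at h2
  have h3 : ((-1 : ℂ) ^ (∑ j, n j)) * (-1) ^ (∑ j, n j) = 1 := by
    rw [← mul_pow]; simp
  rw [coeigenfun, ← hTdef, hder, mul_div_cancel_left₀ _ hx.ne', mul_assoc, Complex.ofReal_mul, h2,
    ← mul_assoc]
  push_cast
  rw [h3, one_mul]
  rfl

/-! ### The spectral expansion -/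

/-- The series `∑ c_n ⟨g_n, f⟩ h_n` as a bounded operator, for families of geometric growth. -/
theorem exists_clm_hasSum {ι H : Type*} [NormedAddCommGroup H] [InnerProductSpace ℂ H]
    [CompleteSpace H] (h g : ι → H) (c : ι → ℂ)
    (hs : Summable fun n => ‖c n‖ * ‖g n‖ * ‖h n‖) :
    ∃ R : H →L[ℂ] H, ∀ f, HasSum (fun n => (c n * inner ℂ (g n) f) • h n) (R f) := by
  let u : ι → H →L[ℂ] H := fun n => c n • (innerSL ℂ (g n)).smulRight (h n)
  have hu : Summable u := by
    refine Summable.of_norm_bounded hs fun n => ?_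
    rw [norm_smul, ContinuousLinearMap.norm_smulRight_apply, innerSL_apply_norm, mul_assoc]
  refine ⟨∑' n, u n, fun f => ?_⟩
  have := hu.hasSum.mapL (ContinuousLinearMap.apply ℂ H f)
  refine this.congr_fun fun n => ?_
  simp [u, smul_smul]

theorem exp_sum_mul_eq_prod (t : ℝ) (lam : Fin d → ℝ) (n : Fin d → ℕ) :
    (Real.exp (-t * ∑ j, (n j : ℝ) * lam j) : ℂ) =
      ∏ j, (Real.exp (-(t * lam j)) : ℂ) ^ n j := by
  simp_rw [← Complex.ofReal_pow, ← Real.exp_nat_mul]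
  rw [← Complex.ofReal_prod, ← Real.exp_sum, Finset.mul_sum]
  congr 3
  ext j; ring

/-- A character of the state space is a multiple of the generating function at an imaginary
argument. -/
theorem character_eq_hermiteGen {S T : Matrix (Fin d) (Fin d) ℝ} (hT : IsUnit T.det)
    (ξ x : EuclideanSpace ℝ (Fin d)) (w : Fin d → ℂ)
    (hw : w = fun j => Complex.I * ((T⁻¹ᵀ *ᵥ ξ.ofLp) j : ℂ)) :
    Complex.exp (inner ℝ x ξ * Complex.I) =
      Complex.exp (1 / 2 * cform (T * S * Tᵀ) w w) * hermiteGen S T w x := by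
  have h1 : ∑ j, w j * ((T *ᵥ x.ofLp) j : ℂ) = inner ℝ x ξ * Complex.I := by
    have h2 : inner ℝ x ξ = (T⁻¹ᵀ *ᵥ ξ.ofLp) ⬝ᵥ (T *ᵥ x.ofLp) := by
      rw [Matrix.dotProduct_mulVec, ← Matrix.mulVec_transpose, Matrix.mulVec_mulVec,
        ← Matrix.transpose_mul, Matrix.nonsing_inv_mul T hT]
      simp [EuclideanSpace.inner_eq_star_dotProduct]
    rw [h2, hw]
    simp only [dotProduct]
    push_cast
    rw [Finset.sum_mul]
    exact Finset.sum_congr rfl fun j _ => by ring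
  rw [hermiteGen, ← Complex.exp_add, h1]
  congr 1; ring

/-- The semigroup acts on the generating function by contracting its argument. -/
theorem integral_kernel_character [NeZero d] {Q B M : Matrix (Fin d) (Fin d) ℝ} {lam : Fin d → ℝ}
    (hQ : Q.PosSemidef) (hM : IsUnit M.det)
    (hB : M * B * M⁻¹ = Matrix.diagonal (fun j => -lam j)) (hlam : ∀ j, 0 < lam j)
    (hT : IsUnit (coord Q B M lam).det) {t : ℝ} (ht : 0 ≤ t)
    (ξ x : EuclideanSpace ℝ (Fin d)) (w : Fin d → ℂ)
    (hw : w = fun j => Complex.I * (((coord Q B M lam)⁻¹ᵀ *ᵥ ξ.ofLp) j : ℂ)) :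
    ∫ y, Complex.exp (inner ℝ y ξ * Complex.I) ∂(kernel Q B t x) =
      Complex.exp (1 / 2 * cform (coord Q B M lam * covInf Q B * (coord Q B M lam)ᵀ) w w) *
        hermiteGen (covInf Q B) (coord Q B M lam)
          (fun j => (Real.exp (-(t * lam j)) : ℂ) * w j) x := by
  set T := coord Q B M lam with hTdef
  set η := Matrix.toEuclideanLin (NormedSpace.exp (t • B))ᵀ ξ with hη
  set D := Matrix.diagonal (fun j => Real.exp (-(t * lam j))) with hD
  have hcomm : T * NormedSpace.exp (t • B) = D * T := coord_mul_exp Q hM hB t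
  have hηT : T⁻¹ᵀ *ᵥ η.ofLp = D *ᵥ (T⁻¹ᵀ *ᵥ ξ.ofLp) := by
    have h1 : NormedSpace.exp (t • B) * T⁻¹ = T⁻¹ * D := by
      rw [← Matrix.nonsing_inv_mul_cancel_left T (NormedSpace.exp (t • B) * T⁻¹) hT,
        ← Matrix.mul_assoc T, hcomm, Matrix.mul_assoc, Matrix.mul_nonsing_inv T hT, Matrix.mul_one]
    have h2 : T⁻¹ᵀ * (NormedSpace.exp (t • B))ᵀ = D * T⁻¹ᵀ := by
      rw [← Matrix.transpose_mul, h1, Matrix.transpose_mul, hD, Matrix.diagonal_transpose]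
    simp only [hη, Matrix.ofLp_toLpLin, Matrix.toLin'_apply, Matrix.mulVec_mulVec, h2]
  have hw' : (fun j => (Real.exp (-(t * lam j)) : ℂ) * w j) =
      fun j => Complex.I * ((T⁻¹ᵀ *ᵥ η.ofLp) j : ℂ) := by
    ext j
    rw [hηT, hD, Matrix.mulVec_diagonal, hw]
    push_cast; ring
  have hquad : ∀ (ζ : EuclideanSpace ℝ (Fin d)), cform (T * covInf Q B * Tᵀ)
      (fun j => Complex.I * ((T⁻¹ᵀ *ᵥ ζ.ofLp) j : ℂ)) (fun j => Complex.I * ((T⁻¹ᵀ *ᵥ ζ.ofLp) j : ℂ)) =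
      -((ζ.ofLp ⬝ᵥ covInf Q B *ᵥ ζ.ofLp : ℝ) : ℂ) := by
    intro ζ
    have h1 := cform_smul_smul (T * covInf Q B * Tᵀ) Complex.I
      (fun j => ((T⁻¹ᵀ *ᵥ ζ.ofLp) j : ℂ)) (fun j => ((T⁻¹ᵀ *ᵥ ζ.ofLp) j : ℂ))
    have h2 : (Tᵀ * T⁻¹ᵀ) = 1 := by
      rw [← Matrix.transpose_mul, Matrix.nonsing_inv_mul T hT, Matrix.transpose_one]
    have h3 : (T⁻¹ᵀ *ᵥ ζ.ofLp) ⬝ᵥ (T * covInf Q B * Tᵀ) *ᵥ (T⁻¹ᵀ *ᵥ ζ.ofLp) =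
        ζ.ofLp ⬝ᵥ covInf Q B *ᵥ ζ.ofLp := by
      rw [Matrix.mulVec_mulVec, Matrix.mul_assoc, h2, Matrix.mul_one, ← Matrix.mulVec_mulVec,
        Matrix.dotProduct_mulVec, ← Matrix.mulVec_transpose, Matrix.mulVec_mulVec, h2,
        Matrix.one_mulVec]
    rw [cform_ofReal, h3, Complex.I_sq] at h1
    rw [neg_one_mul] at h1
    exact h1
  have h1 := character_eq_hermiteGen (S := covInf Q B) hT η x _ rfl
  rw [hquad] at h1
  have h2 := charFun_kernel (posSemidef_covT hQ hM hB hlam ht) x ξ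
  rw [charFun_apply] at h2
  rw [h2, ← hη, h1, hw', hw, hquad, dotProduct_covInf_eq hM hB hlam t ξ, mul_right_comm,
    ← Complex.exp_add]
  congr 2
  push_cast; ring

/-- For large times the exponential decay beats any geometric growth in the order `|n|`. -/
theorem exists_time_summable [NeZero d] {lam : Fin d → ℝ} (hlam : ∀ j, 0 < lam j)
    (hmono : Monotone lam) {R : ℝ} (hR : 1 ≤ R) :
    ∃ t₀ : ℝ, 0 < t₀ ∧ ∀ t, t₀ < t →
      Summable fun n : Fin d → ℕ => Real.exp (-t * ∑ j, (n j : ℝ) * lam j) * R ^ ∑ j, n j := by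
  have h0 : 0 < lam 0 := hlam 0
  -- The growth rate `R` is beaten by the decay once `e^{-t λ₁} R < 1`.
  refine ⟨1 + Real.log R / lam 0, by have := Real.log_nonneg hR; positivity, fun t ht => ?_⟩
  have ht0 : 0 < t := lt_trans (by have := Real.log_nonneg hR; positivity) ht
  have hq1 : Real.exp (-(t * lam 0)) * R < 1 := by
    have h1 : Real.log R < t * lam 0 := by
      rw [← div_lt_iff₀ h0]; linarith
    calc Real.exp (-(t * lam 0)) * R = Real.exp (-(t * lam 0) + Real.log R) := by
          rw [Real.exp_add, Real.exp_log (by linarith)]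
      _ < 1 := (Real.exp_lt_exp.2 (by linarith)).trans_eq Real.exp_zero
  refine Summable.of_nonneg_of_le (fun n => by positivity) (fun n => ?_)
    (summable_geometric_pi (d := d) (q := Real.exp (-(t * lam 0)) * R) (by positivity) hq1)
  rw [mul_pow, ← Real.exp_nat_mul]
  refine mul_le_mul_of_nonneg_right (Real.exp_le_exp.2 ?_) (by positivity)
  have h2 : ((∑ j, n j : ℕ) : ℝ) * lam 0 ≤ ∑ j, (n j : ℝ) * lam j := by
    push_cast
    rw [Finset.sum_mul]
    exact Finset.sum_le_sum fun j _ => mul_le_mul_of_nonneg_left (hmono (Fin.zero_le j))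
      (Nat.cast_nonneg _)
  nlinarith

/-- The spectral expansion in operator form: both sides are bounded operators on `L²`, and they
agree on the characters, whose span is dense. -/
theorem hasSum_semigroup [NeZero d] {Q B M : Matrix (Fin d) (Fin d) ℝ} {lam : Fin d → ℝ}
    (hQ : Q.PosSemidef) (hS : (covInf Q B).PosDef) (hM : IsUnit M.det)
    (hB : M * B * M⁻¹ = Matrix.diagonal (fun j => -lam j)) (hlam : ∀ j, 0 < lam j)
    (hmono : Monotone lam) (hT : IsUnit (coord Q B M lam).det)
    {S T K : Matrix (Fin d) (Fin d) ℝ} (hSdef : S = covInf Q B) (hTdef : T = coord Q B M lam)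
    (hTK : T * S * Kᵀ = 1) :
    ∃ t₀ : ℝ, 0 < t₀ ∧ ∀ t : ℝ, t₀ < t →
      ∀ hinv : (multivariateGaussian 0 S).bind (transKernel Q B t) = multivariateGaussian 0 S,
      ∀ f, ∀ hf : MemLp f 2 (multivariateGaussian 0 S),
      HasSum (fun n => ((Real.exp (-t * ∑ j, (n j : ℝ) * lam j) : ℂ) *
        ∫ y, f y * hermiteFam S K n y ∂(multivariateGaussian 0 S)) •
        (memLp_hermiteFam S T n).toLp _) ((memLp_integral_kernel hinv hf).toLp _) := by
  set γ := multivariateGaussian 0 S with hγ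
  have hSp : S.PosSemidef := hSdef ▸ hS.posSemidef
  obtain ⟨C₁, R₁, hC₁, hR₁, hb₁⟩ := exists_norm_toLp_hermiteFam_le S T
  obtain ⟨C₂, R₂, hC₂, hR₂, hb₂⟩ := exists_norm_toLp_hermiteFam_le S K
  obtain ⟨t₀, ht₀, hsum⟩ := exists_time_summable hlam hmono
    (R := R₂ * R₁) (one_le_mul_of_one_le_of_one_le hR₂ hR₁)
  refine ⟨t₀, ht₀, fun t ht hinv f hf => ?_⟩
  have htpos : 0 < t := ht₀.trans ht
  set H : (Fin d → ℕ) → Lp ℂ 2 γ := fun n => (memLp_hermiteFam S T n).toLp _ with hH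
  set G : (Fin d → ℕ) → Lp ℂ 2 γ := fun n => (memLp_hermiteFam S K n).star.toLp _ with hG
  set c : (Fin d → ℕ) → ℂ := fun n => (Real.exp (-t * ∑ j, (n j : ℝ) * lam j) : ℂ) with hc
  have hinner : ∀ n {f : EuclideanSpace ℝ (Fin d) → ℂ} (hf : MemLp f 2 γ),
      inner ℂ (G n) (hf.toLp f) = ∫ y, f y * hermiteFam S K n y ∂γ := by
    intro n f hf
    rw [L2.inner_def]
    refine integral_congr_ae ?_
    filter_upwards [(memLp_hermiteFam S K n).star.coeFn_toLp, hf.coeFn_toLp] with x h1 h2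
    rw [h1, h2, RCLike.inner_apply]
    simp
  have hGn : ∀ n, ‖G n‖ = ‖(memLp_hermiteFam S K n).toLp _‖ := by
    intro n
    rw [hG, Lp.norm_toLp, Lp.norm_toLp]
    congr 1
    exact eLpNorm_congr_norm_ae (ae_of_all _ fun x => by simp)
  obtain ⟨R, hRsum⟩ := exists_clm_hasSum H G c (by
    refine Summable.of_nonneg_of_le (fun n => by positivity) (fun n => ?_)
      ((hsum t ht).mul_left (C₂ * C₁))
    rw [hGn, hc, Complex.norm_real, Real.norm_of_nonneg (Real.exp_pos _).le]
    calc _ ≤ Real.exp (-t * ∑ j, (n j : ℝ) * lam j) * (C₂ * R₂ ^ ∑ j, n j) *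
          (C₁ * R₁ ^ ∑ j, n j) := by
          gcongr
          · exact hb₂ n
          · exact hb₁ n
      _ = _ := by rw [mul_pow]; ring)
  obtain ⟨P, hP⟩ := exists_continuousLinearMap_kernel hinv
  have hPR : P = R := by
    refine ContinuousLinearMap.ext_on dense_span_characters ?_
    rintro _ ⟨ξ, rfl⟩
    set w : Fin d → ℂ := fun j => Complex.I * (((coord Q B M lam)⁻¹ᵀ *ᵥ ξ.ofLp) j : ℂ) with hw
    set a : ℂ := Complex.exp (1 / 2 * cform (T * S * Tᵀ) w w) with ha
    set w' : Fin d → ℂ := fun j => (Real.exp (-(t * lam j)) : ℂ) * w j with hw'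
    set b : (Fin d → ℂ) → (Fin d → ℕ) → ℂ := fun z n =>
      (∏ j, z j ^ n j) / (Real.sqrt (multiFactorial n) : ℂ) with hb
    have hchar : (memLp_character (μ := γ) ξ).toLp _ =
        a • (memLp_hermiteGen S T w).toLp _ := by
      rw [← MemLp.toLp_const_smul]
      refine MemLp.toLp_congr _ _ (ae_of_all _ fun x => ?_)
      rw [Pi.smul_apply, smul_eq_mul, ha]
      exact character_eq_hermiteGen (hTdef ▸ hT) ξ x w (by rw [hw, hTdef])
    have hPchar : P ((memLp_character (μ := γ) ξ).toLp _) =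
        a • (memLp_hermiteGen S T w').toLp _ := by
      rw [hP, ← MemLp.toLp_const_smul]
      refine MemLp.toLp_congr _ _ (ae_of_all _ fun x => ?_)
      rw [Pi.smul_apply, smul_eq_mul, ha, hw', hSdef, hTdef]
      exact integral_kernel_character hQ hM hB hlam hT htpos.le ξ x w hw
    have hcoef : ∀ n, inner ℂ (G n) ((memLp_character (μ := γ) ξ).toLp _) = a * b w n := by
      intro n
      have h1 := ((hasSum_toLp_hermiteFam hSp T w).const_smul a).mapL (innerSL ℂ (G n))
      rw [← hchar, innerSL_apply_apply] at h1
      have h2 : ∀ m, inner ℂ (G n) (H m) = if n = m then 1 else 0 := by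
        intro m
        rw [hH, hinner]
        exact integral_hermiteFam_mul_hermiteFam hSp hTK m n
      refine h1.unique ((hasSum_ite_eq n (a * b w n)).congr_fun fun m => ?_)
      simp only [map_smul, innerSL_apply_apply, smul_eq_mul]
      rw [h2 m]
      by_cases hmn : n = m
      · subst hmn; simp [hb]
      · simp [hmn, Ne.symm hmn]
    have h1 := hRsum ((memLp_character (μ := γ) ξ).toLp _)
    have h2 := (hasSum_toLp_hermiteFam hSp T w').const_smul a
    rw [hPchar]
    refine h2.unique (h1.congr_fun fun n => ?_)
    rw [hcoef, smul_smul]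
    congr 1
    simp only [hb, hw', hc, exp_sum_mul_eq_prod, mul_pow, Finset.prod_mul_distrib]
    ring
  have := hRsum (hf.toLp f)
  rw [← hPR, hP f hf] at this
  refine this.congr_fun fun n => ?_
  rw [hinner]

end

end OU

theorem theorem3p4 (d : ℕ) [NeZero d] (Q B M : Matrix (Fin d) (Fin d) ℝ) (lam : Fin d → ℝ)
    (hQ : Q.PosSemidef)
    (hQt : ∀ t : ℝ, 0 < t → 0 < (OU.covT Q B t).det)
    (hM : IsUnit M.det)
    (hB : M * B * M⁻¹ = Matrix.diagonal (fun j => -lam j))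
    (hlam_pos : ∀ j, 0 < lam j)
    (hlam_mono : Monotone lam) :
    -- `μ` is the unique invariant distribution
    (OU.IsInvariantDistribution Q B (OU.invMeasure Q B) ∧
      ∀ ν : Measure (EuclideanSpace ℝ (Fin d)),
        OU.IsInvariantDistribution Q B ν → ν = OU.invMeasure Q B) ∧
    -- the two families are in `L²(μ)` and biorthogonal
    (∀ n : Fin d → ℕ, MemLp (OU.eigenfun Q B M lam n) 2 (OU.invMeasure Q B)) ∧
    (∀ n : Fin d → ℕ, MemLp (OU.coeigenfun Q B M lam n) 2 (OU.invMeasure Q B)) ∧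
    (∀ m n : Fin d → ℕ,
      ∫ x, OU.eigenfun Q B M lam n x * OU.coeigenfun Q B M lam m x ∂(OU.invMeasure Q B) =
        if m = n then 1 else 0) ∧
    -- the expansion, as an unconditionally convergent series in `L²(μ)`
    ∃ t₀ : ℝ, 0 < t₀ ∧ ∀ t : ℝ, t₀ < t → ∀ f : EuclideanSpace ℝ (Fin d) → ℂ,
      MemLp f 2 (OU.invMeasure Q B) →
      (∀ᵐ x ∂(OU.invMeasure Q B), Integrable f (OU.kernel Q B t x)) ∧
      MemLp (OU.semigroup Q B t f) 2 (OU.invMeasure Q B) ∧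
      Tendsto
        (fun s : Finset (Fin d → ℕ) =>
          eLpNorm
            (fun x => OU.semigroup Q B t f x -
              ∑ n ∈ s, (Real.exp (-t * ∑ j, (n j : ℝ) * lam j) : ℂ) *
                (∫ y, f y * (OU.coeigenfun Q B M lam n y : ℂ) ∂(OU.invMeasure Q B)) *
                (OU.eigenfun Q B M lam n x : ℂ))
            2 (OU.invMeasure Q B))
        atTop (𝓝 0) := by
  have hS := OU.posDef_covInf hQ hQt hM hB hlam_pos
  have hT := OU.isUnit_det_coord (lam := lam) hS hM hlam_pos
  have hTK := OU.coord_mul_dualCoord hS hT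
  have hmemH := OU.memLp_hermiteFam (OU.covInf Q B) (OU.coord Q B M lam)
  have hmemG := OU.memLp_hermiteFam (OU.covInf Q B)
    (OU.dualCoord (OU.covInf Q B) (OU.coord Q B M lam))
  have hEq : ∀ n x, OU.hermiteFam (OU.covInf Q B) (OU.coord Q B M lam) n x =
      (OU.eigenfun Q B M lam n x : ℂ) := fun n x => (OU.eigenfun_eq_hermiteFam M lam hS n x).symm
  have hGq : ∀ n x, OU.hermiteFam (OU.covInf Q B)
      (OU.dualCoord (OU.covInf Q B) (OU.coord Q B M lam)) n x =
      (OU.coeigenfun Q B M lam n x : ℂ) := fun n x => (OU.coeigenfun_eq_hermiteFam hS hT n x).symm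
  have hmu := OU.invMeasure_eq hS
  have hinv : ∀ t : ℝ, 0 < t → (multivariateGaussian 0 (OU.covInf Q B)).bind
      (OU.transKernel Q B t) = multivariateGaussian 0 (OU.covInf Q B) :=
    fun t ht => OU.bind_transKernel_eq hQ hS hM hB hlam_pos ht.le
  rw [hmu]
  refine ⟨⟨OU.isInvariantDistribution_iff.2 hinv, fun ν hν => ?_⟩, fun n => ?_, fun n => ?_,
    fun m n => ?_, ?_⟩
  · have := hν.1
    exact OU.eq_gaussian_of_invariant hQ hS hM hB hlam_pos ν (OU.isInvariantDistribution_iff.1 hν)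
  · refine (hmemH n).re.ae_eq (ae_of_all _ fun x => ?_)
    simp [hEq]
  · refine (hmemG n).re.ae_eq (ae_of_all _ fun x => ?_)
    simp [hGq]
  · have h := OU.integral_hermiteFam_mul_hermiteFam hS.posSemidef hTK n m
    simp only [hEq, hGq, ← Complex.ofReal_mul] at h
    rw [integral_complex_ofReal] at h
    split_ifs at h ⊢ with hmn <;> exact_mod_cast h
  · obtain ⟨t₀, ht₀, hsum⟩ := OU.hasSum_semigroup hQ hS hM hB hlam_pos hlam_mono hT rfl rfl hTK
    refine ⟨t₀, ht₀, fun t ht f hf => ?_⟩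
    have hi := hinv t (ht₀.trans ht)
    have hmem := OU.memLp_integral_kernel hi hf
    refine ⟨OU.ae_integrable_kernel hi hf, hmem, ?_⟩
    have h := hsum t ht hi f hf
    rw [HasSum, SummationFilter.unconditional_filter, Lp.tendsto_Lp_iff_tendsto_eLpNorm'] at h
    refine h.congr fun s => ?_
    rw [← eLpNorm_neg]
    refine eLpNorm_congr_ae ?_
    have hall : ∀ᵐ x ∂(multivariateGaussian 0 (OU.covInf Q B)), ∀ n ∈ s,
        (((Real.exp (-t * ∑ j, (n j : ℝ) * lam j) : ℂ) *
          ∫ y, f y * OU.hermiteFam (OU.covInf Q B)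
            (OU.dualCoord (OU.covInf Q B) (OU.coord Q B M lam)) n y
            ∂(multivariateGaussian 0 (OU.covInf Q B))) • (hmemH n).toLp _ : Lp ℂ 2 _) x =
        (Real.exp (-t * ∑ j, (n j : ℝ) * lam j) : ℂ) *
          (∫ y, f y * (OU.coeigenfun Q B M lam n y : ℂ)
            ∂(multivariateGaussian 0 (OU.covInf Q B))) * (OU.eigenfun Q B M lam n x : ℂ) := by
      refine (Filter.eventually_all_finset s).2 fun n _ => ?_
      filter_upwards [Lp.coeFn_smul ((Real.exp (-t * ∑ j, (n j : ℝ) * lam j) : ℂ) *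
          ∫ y, f y * OU.hermiteFam (OU.covInf Q B)
            (OU.dualCoord (OU.covInf Q B) (OU.coord Q B M lam)) n y
            ∂(multivariateGaussian 0 (OU.covInf Q B))) ((hmemH n).toLp _),
        (hmemH n).coeFn_toLp] with x h1 h2
      rw [h1, Pi.smul_apply, h2, hEq, smul_eq_mul]
      simp only [hGq]
    filter_upwards [hall, Lp.coeFn_finsetSum s (fun n =>
      (((Real.exp (-t * ∑ j, (n j : ℝ) * lam j) : ℂ) *
          ∫ y, f y * OU.hermiteFam (OU.covInf Q B)
            (OU.dualCoord (OU.covInf Q B) (OU.coord Q B M lam)) n y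
            ∂(multivariateGaussian 0 (OU.covInf Q B))) • (hmemH n).toLp _ : Lp ℂ 2 _)),
      hmem.coeFn_toLp] with x h1 h2 h3
    rw [Pi.neg_apply, Pi.sub_apply, h2, h3, Finset.sum_apply, neg_sub]
    congr 1
    exact Finset.sum_congr rfl h1
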